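/- Let $\mathcal H,\mathcal G$ be complex Hilbert spaces and let $\mathcal A:\mathcal D(\mathcal A)\subset\mathcal H\to\mathcal H$ be self-adjoint with compact resolvent and semibounded, i.e. $\langle \mathcal A x,x\rangle\ge -c\|x\|^2$ on $\mathcal D(\mathcal A)$ for some $c>0$. Let $\{\phi_n\}$ be an orthonormal basis of $\mathcal H$ consisting of eigenvectors of $\mathcal A$, $\mathcal A\phi_n=\mu_n\phi_n$, and let $\mathcal H^1=\mathcal D(|\mathcal A|^{1/2})$ with $\|x\|_1^2=\|x\|^2+\||\mathcal A|^{1/2}x\|^2=\|x\|^2+\sum_n|\mu_n||\langle x,\phi_n\rangle|^2$. Let $\mathcal B:\mathcal D(\mathcal B)\subset\mathcal H\to\mathcal G$ be a linear operator that is closed; it suffices that it is closed relative to $\mathcal A$, i.e. that $\{(x,\mathcal Ax,\mathcal Bx):x\in\mathcal D(\mathcal A)\cap\mathcal D(\mathcal B)\}$ is closed in $\mathcal H\times\mathcal H\times\mathcal G$. For a path $v:[0,T]\to\mathcal H$, the observation $\mathcal Bv\in L^2(0,T;\mathcal G)$ is the function $g$ with $\int_0^t v\,ds\in\mathcal D(\mathcal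 B)$ and $\mathcal B\int_0^t v\,ds=\int_0^t g\,ds$ for all $t\in[0,T]$ (for closed $\mathcal B$: $v(t)\in\mathcal D(\mathcal B)$ and $\mathcal B(v(t))=g(t)$ for almost every $t$). Let $T_0\ge 0$ be such that for every $T>T_0$ there is $C>0$ such that for all $(w_0,w_1)\in\mathcal H^1\times\mathcal H$ the mild solution $w$ of $w''+\mathcal Aw=0$ on $[0,T]$, $w(0)=w_0$, $w'(0)=w_1$, has an observation $\mathcal Bw\in L^2(0,T;\mathcal G)$ with $$C^{-1}\left(\|w_0\|_1^2+\|w_1\|^2\right)^{1/2}\le\|\mathcal Bw\|_{L^2(0,T;\mathcal G)}\le C\left(\|w_0\|_1^2+\|w_1\|^2\right)^{1/2}.$$ Let $T>T_0$, let $M\in H^2(0,T)$, and let $\sigma\in C^1[0,T]$ with $\sigma(0)\ne0$ ($M$ and $\sigma$ may be complex-valued). Then there are $\theta_n\in L^2(0,T;\mathcal G)$, depending neither on $f$ nor on $u$, such that for every $f\in\mathcal H$ and every solution $u$ on $[0,T]$ (twice differentiable in $\mathcal H$, with $u(t)\in\mathcal D(\mathcal A)$ and $\mathcal Au$ continuous)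 of $$u''(t)+\mathcal Au(t)=\int_0^tM(t-s)\mathcal Au(s)\,ds+\sigma(t)f,\qquad u(0)=0,\quad u'(0)=0,$$ the observation $\mathcal Bu'$ exists in $L^2(0,T;\mathcal G)$ and $$f=\sum_n\phi_n\,\langle\mathcal Bu',\theta_n\rangle_{L^2(0,T;\mathcal G)},$$ with unconditional convergence in $\mathcal H$. -/

import Mathlib

open MeasureTheory Set

noncomputable section

/-- Condition (A): `A` is an (unbounded) self-adjoint operator in `H`, with compact resolvent and
bounded from below. Dense domain and closedness are part of self-adjointness. -/
structure ConditionA {H : Type*} [NormedAddCommGroup H] [InnerProductSpace ℂ H] [CompleteSpace H]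
    (A : H →ₗ.[ℂ] H) : Prop where
  selfAdjoint : IsSelfAdjoint A
  /-- For some `z`, the operator `A - z` has a two-sided inverse `R` that is bounded on all of `H`
  and compact. -/
  compactResolvent : ∃ (z : ℂ) (R : H →L[ℂ] H), IsCompactOperator R ∧
    (∀ x : H, (R x, x + z • R x) ∈ A.graph) ∧
    (∀ x : A.domain, R (A x - z • (x : H)) = x)
  semibounded : ∃ c : ℝ, 0 < c ∧ ∀ x : A.domain, -c * ‖(x : H)‖ ^ 2 ≤ (inner ℂ (A x) (x : H)).re

/-- `φ` is an orthonormal basis of `H` made of eigenvectors of `A`, with eigenvalues `μ`. -/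
def IsEigenbasis {H ι : Type*} [NormedAddCommGroup H] [InnerProductSpace ℂ H]
    (A : H →ₗ.[ℂ] H) (φ : HilbertBasis ι ℂ H) (μ : ι → ℝ) : Prop :=
  ∀ i, (φ i, (μ i : ℂ) • φ i) ∈ A.graph

/-- The form domain `H¹ = D(|A|^{1/2})`, that is, the completion of `D(A)` for
`‖x‖² + ‖|A|^{1/2} x‖²`, described in an eigenbasis `φ` of `A` with eigenvalues `μ`
(it does not depend on the choice of the eigenbasis). -/
def MemH1 {H ι : Type*} [NormedAddCommGroup H] [InnerProductSpace ℂ H]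
    (φ : HilbertBasis ι ℂ H) (μ : ι → ℝ) (x : H) : Prop :=
  Summable fun i => |μ i| * ‖inner ℂ (φ i) x‖ ^ 2

/-- The norm of `(w₀, w₁)` in `H¹ × H`, where `‖x‖_{H¹}² = ‖x‖² + ‖|A|^{1/2} x‖²` and
`‖|A|^{1/2} x‖² = ∑ |μ i| |⟨x, φ i⟩|²`. -/
def energyNorm {H ι : Type*} [NormedAddCommGroup H] [InnerProductSpace ℂ H]
    (φ : HilbertBasis ι ℂ H) (μ : ι → ℝ) (w₀ w₁ : H) : ℝ :=
  Real.sqrt (‖w₀‖ ^ 2 + ∑' i, |μ i| * ‖inner ℂ (φ i) w₀‖ ^ 2 + ‖w₁‖ ^ 2)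

/-- The space `L²([0,T]; G)`. -/
abbrev L2Time (T : ℝ) (G : Type*) [NormedAddCommGroup G] : Type _ :=
  Lp G 2 (volume.restrict (Icc (0 : ℝ) T))

/-- `g ∈ L²([0,T]; G)` is the observation `B v` of the path `v : [0,T] → H`. The operator `B` is
applied in the sense of distributions in time: `B (∫₀ᵗ v) = ∫₀ᵗ g` for all `t ∈ [0,T]`. This
determines `g`. If `B` is a closed operator in `H`, it says precisely that `v t ∈ D(B)` and
`B (v t) = g t` for almost every `t`. For operators such as boundary traces it is the usual
extension of the observation from smooth solutions to solutions of finite energy. -/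
def IsObservation {H G : Type*} [NormedAddCommGroup H] [InnerProductSpace ℂ H]
    [NormedAddCommGroup G] [InnerProductSpace ℂ G]
    (B : H →ₗ.[ℂ] G) (T : ℝ) (v : ℝ → H) (g : L2Time T G) : Prop :=
  IntervalIntegrable v volume 0 T ∧
    ∀ t ∈ Icc (0 : ℝ) T, (∫ s in (0 : ℝ)..t, v s, ∫ s in (0 : ℝ)..t, g s) ∈ B.graph

/-- `w` is the (mild) solution on `[0,T]` of `w'' + A w = 0`, `w(0) = w₀`, `w'(0) = w₁`: it is
differentiable, and `w'(t) + A ∫₀ᵗ w(s) ds = w₁` for all `t ∈ [0,T]`. -/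
def IsWaveSolution {H : Type*} [NormedAddCommGroup H] [InnerProductSpace ℂ H]
    (A : H →ₗ.[ℂ] H) (T : ℝ) (w₀ w₁ : H) (w : ℝ → H) : Prop :=
  w 0 = w₀ ∧ ∃ a : ℝ → H, ∀ t ∈ Icc (0 : ℝ) T,
    (∫ s in (0 : ℝ)..t, w s, a t) ∈ A.graph ∧ HasDerivWithinAt w (w₁ - a t) (Icc 0 T) t

/-- `B` is closed relative to `A`: if `xₙ ∈ D(A) ∩ D(B)` and `xₙ → x`, `A xₙ → y`, `B xₙ → z`, then
`x ∈ D(A) ∩ D(B)`, `A x = y` and `B x = z`. -/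
def IsClosedRelTo {H G : Type*} [NormedAddCommGroup H] [InnerProductSpace ℂ H]
    [NormedAddCommGroup G] [InnerProductSpace ℂ G] (A : H →ₗ.[ℂ] H) (B : H →ₗ.[ℂ] G) : Prop :=
  IsClosed {p : H × H × G | (p.1, p.2.1) ∈ A.graph ∧ (p.1, p.2.2) ∈ B.graph}

/-- A closed operator `B` is in particular closed relative to any closed operator `A`. -/
theorem IsClosedRelTo.of_isClosed {H G : Type*} [NormedAddCommGroup H] [InnerProductSpace ℂ H]
    [NormedAddCommGroup G] [InnerProductSpace ℂ G] {A : H →ₗ.[ℂ] H} {B : H →ₗ.[ℂ] G}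
    (hA : A.IsClosed) (hB : B.IsClosed) : IsClosedRelTo A B :=
  (IsClosed.preimage (f := fun p : H × H × G => (p.1, p.2.1)) (by fun_prop) hA).inter
    (IsClosed.preimage (f := fun p : H × H × G => (p.1, p.2.2)) (by fun_prop) hB)

/-- Condition (B), with the time `T₀`: `B` is closed, and for every `T > T₀` the two-sided
observability-regularity inequality holds for all finite-energy solutions of `w'' + A w = 0`.
Closedness is only required in the weak form relative to `A`, which includes both operators that
are closed in `H` and boundary trace operators that are continuous on `D(A)`. -/
structure ConditionB {H G ι : Type*} [NormedAddCommGroup H] [InnerProductSpace ℂ H]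
    [NormedAddCommGroup G] [InnerProductSpace ℂ G]
    (A : H →ₗ.[ℂ] H) (B : H →ₗ.[ℂ] G) (φ : HilbertBasis ι ℂ H) (μ : ι → ℝ) (T₀ : ℝ) : Prop where
  nonneg : 0 ≤ T₀
  closed : IsClosedRelTo A B
  observability : ∀ T : ℝ, T₀ < T → ∃ C : ℝ, 0 < C ∧
    ∀ (w₀ w₁ : H) (w : ℝ → H), MemH1 φ μ w₀ → IsWaveSolution A T w₀ w₁ w →
      ∃ Bw : L2Time T G, IsObservation B T w Bw ∧
        C⁻¹ * energyNorm φ μ w₀ w₁ ≤ ‖Bw‖ ∧ ‖Bw‖ ≤ C * energyNorm φ μ w₀ w₁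

/-- `M ∈ H²(0,T)`: up to a null set, `M` is the function with `M(0) = c₀`, `M'(0) = c₁` and
second derivative `M₂ ∈ L²(0,T)`. -/
def MemH2 (T : ℝ) (M : ℝ → ℂ) : Prop :=
  ∃ (c₀ c₁ : ℂ) (M₂ : ℝ → ℂ), MemLp M₂ 2 (volume.restrict (Icc (0 : ℝ) T)) ∧
    ∀ᵐ t ∂(volume.restrict (Icc (0 : ℝ) T)),
      M t = c₀ + ∫ s in (0 : ℝ)..t, (c₁ + ∫ r in (0 : ℝ)..s, M₂ r)

/-- `u`, with derivative `u'`, is a solution on `[0,T]` of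
`u''(t) + A u(t) = ∫₀ᵗ M(t-s) A u(s) ds + σ(t) f`, `u(0) = 0`, `u'(0) = 0`; here `Au t = A (u t)`
is continuous in `t`. -/
def IsSourceSolution {H : Type*} [NormedAddCommGroup H] [InnerProductSpace ℂ H]
    (A : H →ₗ.[ℂ] H) (T : ℝ) (M σ : ℝ → ℂ) (f : H) (u u' : ℝ → H) : Prop :=
  u 0 = 0 ∧ u' 0 = 0 ∧ ∃ Au : ℝ → H, ContinuousOn Au (Icc 0 T) ∧
    ∀ t ∈ Icc (0 : ℝ) T, (u t, Au t) ∈ A.graph ∧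
      HasDerivWithinAt u (u' t) (Icc 0 T) t ∧
      HasDerivWithinAt u' (-Au t + (∫ s in (0 : ℝ)..t, M (t - s) • Au s) + σ t • f) (Icc 0 T) t

end

/-! ### Scalar wave modes and their product formula. -/

noncomputable section

/-! The velocity `u'` is compared, mode by mode and then in `L²` of the observation space, with the
undamped wave `w` with data `w(0) = 0`, `w'(0) = f`. Let `f i` and `z` be the coefficients of the
source and of `u` at `φ i`, and let `s i` solve `x'' + μ i x = 0` with data `(0, 1)`. Then `w` has
coefficients `f i * s i`, and `u'` should be `σ(0) w` plus terms of Volterra type. The difficulty is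
to estimate these terms after observation, uniformly in the unbounded eigenvalues.

First the eigenvalue is removed. With `α = M(0)/2`, `N(t) = exp(α t) M(t)` and `y = (exp(α t) z)'`,
the memory term combines with the elastic one: `ξ = y - N * y` solves a wave equation with the same
`μ i` and a forcing in which the term `N(0) y` has cancelled. Variation of constants
(`IsMode.eq_of_integral_eq`, `exists_isReducedMode`) gives `y = N * y + σ(0) f s + s * (f S - κ y -
m * y)`, whose data `N, m, S, κ` are common to all modes. The second derivative of `M` enters only
through the integrable kernel `m`.

Next take finite sums against `b i = B (φ i)`. The term `s * y` leads to `∑ y i (t) s i (a) b i`,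
which is not a function of the observed path alone. The identity `s(a) s(t) = ½ ∫ s` over `[|a - t|,
a + t]` has limits independent of `μ`, so multiplying the reduced equation by `s i (a)` closes a
Volterra inequality for these two-parameter sums on the triangle `t + a ≤ R`. They are thus bounded
by the `L¹` norm of the wave observation on `[0, R]` (`norm_sum_mul_le_integral`). A Gronwall
argument in both directions, with `σ(0) ≠ 0` for the converse, makes `∑ x i b i`, with `x i` the
coefficients of `u'`, comparable in `L²` to `∑ f i s i b i`, with constants independent of the
finite set (`exists_integral_norm_sq_le`).

The observability inequality then makes these sums comparable to `∑ f i φ i`. Hence the series for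
`B u'` converges, relative closedness identifies its sum, and `‖f‖` is bounded by a multiple of `‖B
u'‖` (`exists_observation`). Each coefficient of `f` is therefore a bounded functional of `B u'`;
Hahn–Banach and Riesz represent it by some `θ n`. -/

/-- `s` and `c = s'` are the solutions of `x'' + μ x = 0` with initial data `(0, 1)` and `(1, 0)`;
the product formula for `s` is part of the structure. -/
structure IsMode (μ : ℝ) (s c : ℝ → ℂ) : Prop where
  zero : s 0 = 0
  one : c 0 = 1
  hasDerivAt : ∀ t, HasDerivAt s (c t) t
  hasDerivAt' : ∀ t, HasDerivAt c (-(μ : ℂ) * s t) t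
  mul_eq : ∀ a b, s a * s b = (1 / 2) * ∫ q in |a - b|..(a + b), s q

namespace IsMode

variable {μ : ℝ} {s c : ℝ → ℂ}

theorem continuous (h : IsMode μ s c) : Continuous s :=
  continuous_iff_continuousAt.2 fun t => (h.hasDerivAt t).continuousAt

theorem one_sub_eq (h : IsMode μ s c) (t : ℝ) : 1 - μ * ∫ r in (0 : ℝ)..t, s r = c t := by
  have := intervalIntegral.integral_eq_sub_of_hasDerivAt (a := 0) (b := t)
    (fun x _ => h.hasDerivAt' x)
    ((continuous_const.mul h.continuous).intervalIntegrable _ _)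
  rw [intervalIntegral.integral_const_mul, h.one] at this
  linear_combination this

end IsMode

/-- With a complex root `ω² = μ`, the formula `sin(ω t)/ω` covers both signs of a nonzero `μ`; only
`μ = 0` is separate. The product formula is `cos(x - y) - cos(x + y) = 2 sin x sin y`, with the
difference of cosines written as an integral. -/
theorem exists_isMode (μ : ℝ) : ∃ s c : ℝ → ℂ, IsMode μ s c := by
  by_cases hμ : μ = 0
  · subst hμ
    refine ⟨fun t => t, fun _ => 1, by simp, rfl, fun t => Complex.ofRealCLM.hasDerivAt,
      fun t => by simpa using hasDerivAt_const t (1 : ℂ), fun a b => ?_⟩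
    rw [intervalIntegral.integral_ofReal, integral_id]
    push_cast
    rw [← Complex.ofReal_pow, sq_abs]
    push_cast
    ring
  · obtain ⟨ω, hω⟩ : ∃ ω : ℂ, ω ^ 2 = μ := IsAlgClosed.exists_pow_nat_eq _ (by norm_num)
    have hω0 : ω ≠ 0 := by
      rintro rfl
      simp only [ne_eq, OfNat.ofNat_ne_zero, not_false_eq_true, zero_pow] at hω
      exact hμ (by exact_mod_cast hω.symm)
    have hlin : ∀ t : ℝ, HasDerivAt (fun t : ℝ => ω * (t : ℂ)) ω t := fun t => by
      simpa using (Complex.ofRealCLM.hasDerivAt (x := t)).const_mul ω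
    have hs : ∀ t : ℝ, HasDerivAt (fun t : ℝ => Complex.sin (ω * t) / ω) (Complex.cos (ω * t)) t :=
      fun t => by
        have := ((Complex.hasDerivAt_sin (ω * t)).comp t (hlin t)).div_const ω
        simpa [hω0, Function.comp_def] using this
    have hc : ∀ t : ℝ, HasDerivAt (fun t : ℝ => Complex.cos (ω * t))
        (-(μ : ℂ) * (Complex.sin (ω * t) / ω)) t := fun t => by
      have := (Complex.hasDerivAt_cos (ω * t)).comp t (hlin t)
      refine this.congr_deriv ?_
      rw [← hω]; field_simp
    refine ⟨_, _, by simp, by simp, hs, hc, fun a b => ?_⟩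
    have hcont : Continuous fun t : ℝ => Complex.sin (ω * t) / ω := by fun_prop
    have hint := intervalIntegral.integral_eq_sub_of_hasDerivAt (a := |a - b|) (b := a + b)
      (fun x _ => hc x) ((continuous_const.mul hcont).intervalIntegrable _ _)
    rw [intervalIntegral.integral_const_mul] at hint
    -- Evenness of the cosine makes the absolute value in the lower limit harmless.
    have habs : Complex.cos (ω * ((|a - b| : ℝ) : ℂ)) = Complex.cos (ω * ((a - b : ℝ) : ℂ)) := by
      rcases abs_choice (a - b) with h | h <;> rw [h]
      push_cast
      rw [← Complex.cos_neg]; congr 1; ring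
    rw [habs] at hint
    push_cast at hint
    rw [mul_add, mul_sub, Complex.cos_add, Complex.cos_sub] at hint
    have hμ' : (μ : ℂ) ≠ 0 := by exact_mod_cast hμ
    apply mul_left_cancel₀ hμ'
    rw [← hω] at hint ⊢
    rw [div_mul_div_comm, ← sq, mul_div_cancel₀ _ (pow_ne_zero 2 hω0)]
    linear_combination (1 / 2) * hint

/-! ### Causal convolutions, Fubini on a triangle, variation of constants. -/

/-- The convolution over `[0,t]` of `p`, given on `[0,T]`, with a path `y` that vanishes for
negative times. -/
def causalConv {E : Type*} [NormedAddCommGroup E] [NormedSpace ℂ E] (T : ℝ) (p : ℝ → ℂ)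
    (y : ℝ → E) (t : ℝ) : E := ∫ r in (0 : ℝ)..T, p r • y (t - r)

theorem intervalIntegral_swap {E : Type*} [NormedAddCommGroup E] [NormedSpace ℝ E] {a b c d : ℝ}
    {F : ℝ → ℝ → E} (hF : Integrable (Function.uncurry F)
      ((volume.restrict (uIoc a b)).prod (volume.restrict (uIoc c d)))) :
    ∫ x in a..b, ∫ y in c..d, F x y = ∫ y in c..d, ∫ x in a..b, F x y := by
  simp only [intervalIntegral.intervalIntegral_eq_integral_uIoc, integral_smul]
  rw [integral_integral_swap hF, smul_comm]

section causalConv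

variable {E : Type*} [NormedAddCommGroup E] [NormedSpace ℂ E] {T : ℝ} {p : ℝ → ℂ}

theorem intervalIntegrable_smul_comp_sub (hp : IntervalIntegrable p volume 0 T) {y : ℝ → E}
    (hy : Continuous y) (t a b : ℝ) (h : uIcc a b ⊆ uIcc 0 T := by exact subset_rfl) :
    IntervalIntegrable (fun r => p r • y (t - r)) volume a b :=
  (hp.mono_set h).smul_continuousOn (by fun_prop)

theorem continuous_causalConv (hp : IntervalIntegrable p volume 0 T) {y : ℝ → E}
    (hy : Continuous y) : Continuous (causalConv T p y) := by
  refine continuous_iff_continuousAt.2 fun t₀ => ?_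
  obtain ⟨C, hC⟩ := ((isCompact_Icc (a := t₀ - 1) (b := t₀ + 1)).prod
    (isCompact_uIcc (a := 0) (b := T))).exists_bound_of_continuousOn
    (f := fun x : ℝ × ℝ => y (x.1 - x.2)) (by fun_prop)
  refine intervalIntegral.continuousAt_of_dominated_interval (bound := fun r => ‖p r‖ * C) ?_ ?_ ?_
    ?_
  · exact Filter.Eventually.of_forall fun t =>
      (intervalIntegrable_smul_comp_sub hp hy t 0 T).aestronglyMeasurable_restrict_uIoc
  · filter_upwards [Icc_mem_nhds (by linarith : t₀ - 1 < t₀) (by linarith : t₀ < t₀ + 1)] with t ht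
    refine Filter.Eventually.of_forall fun r hr => ?_
    rw [norm_smul]
    exact mul_le_mul_of_nonneg_left (hC (t, r) ⟨ht, uIoc_subset_uIcc hr⟩) (norm_nonneg _)
  · exact hp.norm.mul_const C
  · exact Filter.Eventually.of_forall fun r _ => by fun_prop

theorem causalConv_eq (hT : 0 ≤ T) {t : ℝ} (ht : t ∈ Icc 0 T)
    (hp : IntervalIntegrable p volume 0 T) {y : ℝ → E} (hy : Continuous y)
    (hy0 : ∀ t ≤ 0, y t = 0) : causalConv T p y t = ∫ r in (0 : ℝ)..t, p r • y (t - r) := by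
  have h1 : uIcc 0 t ⊆ uIcc 0 T := by
    rw [uIcc_of_le hT, uIcc_of_le ht.1]; exact Icc_subset_Icc_right ht.2
  have h2 : uIcc t T ⊆ uIcc 0 T := by
    rw [uIcc_of_le hT, uIcc_of_le ht.2]; exact Icc_subset_Icc_left ht.1
  rw [causalConv, ← intervalIntegral.integral_add_adjacent_intervals
    (intervalIntegrable_smul_comp_sub hp hy t 0 t h1)
    (intervalIntegrable_smul_comp_sub hp hy t t T h2), add_eq_left]
  refine intervalIntegral.integral_zero_ae (Filter.Eventually.of_forall fun r hr => ?_)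
  rw [uIoc_of_le ht.2] at hr
  rw [hy0 _ (by linarith [hr.1]), smul_zero]

theorem causalConv_eq' (hT : 0 ≤ T) {t : ℝ} (ht : t ∈ Icc 0 T)
    (hp : IntervalIntegrable p volume 0 T) {y : ℝ → E} (hy : Continuous y)
    (hy0 : ∀ t ≤ 0, y t = 0) : causalConv T p y t = ∫ r in (0 : ℝ)..t, p (t - r) • y r := by
  rw [causalConv_eq hT ht hp hy hy0]
  have := intervalIntegral.integral_comp_sub_left (a := 0) (b := t) (fun r => p (t - r) • y r) t
  simpa using this

theorem integral_of_nonpos {y : ℝ → E} (hy0 : ∀ t ≤ 0, y t = 0) {t : ℝ} (ht : t ≤ 0) :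
    ∫ r in (0 : ℝ)..t, y r = 0 := by
  refine intervalIntegral.integral_zero_ae (Filter.Eventually.of_forall fun r hr => ?_)
  rw [uIoc_of_ge ht] at hr
  exact hy0 _ hr.2

theorem continuous_primitive_of_continuous [CompleteSpace E] {y : ℝ → E} (hy : Continuous y) :
    Continuous fun t => ∫ r in (0 : ℝ)..t, y r :=
  intervalIntegral.continuous_primitive (fun a b => hy.intervalIntegrable a b) 0

theorem integral_causalConv [CompleteSpace E] (hT : 0 ≤ T) (hp : IntervalIntegrable p volume 0 T)
    {y : ℝ → E} (hy : Continuous y) (hy0 : ∀ t ≤ 0, y t = 0) (t : ℝ) :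
    ∫ τ in (0 : ℝ)..t, causalConv T p y τ =
      causalConv T p (fun t => ∫ r in (0 : ℝ)..t, y r) t := by
  have hint : Integrable (Function.uncurry fun τ r => p r • y (τ - r))
      ((volume.restrict (uIoc 0 t)).prod (volume.restrict (uIoc 0 T))) := by
    obtain ⟨C, hC⟩ := ((isCompact_uIcc (a := 0) (b := t)).prod
      (isCompact_uIcc (a := 0) (b := T))).exists_bound_of_continuousOn
      (f := fun x : ℝ × ℝ => y (x.1 - x.2)) (by fun_prop)
    have : IsFiniteMeasure (volume.restrict (uIoc 0 t)) :=
      ⟨by simp [uIoc, Real.volume_Ioc]⟩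
    have h1 : Integrable (fun x : ℝ × ℝ => p x.2)
        ((volume.restrict (uIoc 0 t)).prod (volume.restrict (uIoc 0 T))) :=
      (intervalIntegrable_iff.1 hp).integrable.comp_snd _
    refine h1.smul_bdd C (Continuous.aestronglyMeasurable (by fun_prop)) ?_
    rw [Measure.prod_restrict]
    refine (ae_restrict_mem (measurableSet_uIoc.prod measurableSet_uIoc)).mono fun x hx => ?_
    exact hC x ⟨uIoc_subset_uIcc hx.1, uIoc_subset_uIcc hx.2⟩
  simp only [causalConv]
  rw [intervalIntegral_swap hint]
  refine intervalIntegral.integral_congr fun r hr => ?_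
  rw [uIcc_of_le hT] at hr
  rw [intervalIntegral.integral_smul, intervalIntegral.integral_comp_sub_right, zero_sub]
  rw [← intervalIntegral.integral_interval_sub_left (hy.intervalIntegrable 0 _)
    (hy.intervalIntegrable 0 _), integral_of_nonpos hy0 (t := -r) (by linarith [hr.1]), sub_zero]

end causalConv

/-- Fubini's theorem on a triangle, for a product. -/
theorem integral_mul_primitive_eq {T : ℝ} (hT : 0 ≤ T) {p q : ℝ → ℂ}
    (hp : IntervalIntegrable p volume 0 T) (hq : IntervalIntegrable q volume 0 T) :
    ∫ s in (0 : ℝ)..T, p s * ∫ r in (0 : ℝ)..s, q r =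
      ∫ r in (0 : ℝ)..T, (∫ s in r..T, p s) * q r := by
  have hp' := (intervalIntegrable_iff_integrableOn_Ioc_of_le hT).1 hp
  have hq' := (intervalIntegrable_iff_integrableOn_Ioc_of_le hT).1 hq
  have hint : Integrable (Function.uncurry fun s r => {x : ℝ × ℝ | x.2 ≤ x.1}.indicator
      (fun x => p x.1 * q x.2) (s, r))
      ((volume.restrict (uIoc 0 T)).prod (volume.restrict (uIoc 0 T))) := by
    rw [uIoc_of_le hT]
    exact (hp'.mul_prod hq').indicator (measurableSet_le measurable_snd measurable_fst)
  have hswap := intervalIntegral_swap hint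
  have e1 : ∀ s ∈ uIcc 0 T, ∫ r in (0 : ℝ)..T, {x : ℝ × ℝ | x.2 ≤ x.1}.indicator
      (fun x => p x.1 * q x.2) (s, r) = p s * ∫ r in (0 : ℝ)..s, q r := fun s hs => by
    rw [uIcc_of_le hT] at hs
    rw [← intervalIntegral.integral_const_mul, intervalIntegral.integral_of_le hT,
      intervalIntegral.integral_of_le hs.1, ← integral_indicator measurableSet_Ioc,
      ← integral_indicator measurableSet_Ioc]
    congr 1; ext r
    have : r ≤ s → r ≤ T := fun h => h.trans hs.2
    simp only [indicator, mem_Ioc, mem_ofPred_eq]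
    grind
  have e2 : ∀ r ∈ uIoc 0 T, ∫ s in (0 : ℝ)..T, {x : ℝ × ℝ | x.2 ≤ x.1}.indicator
      (fun x => p x.1 * q x.2) (s, r) = (∫ s in r..T, p s) * q r := fun r hr => by
    rw [uIoc_of_le hT] at hr
    -- The slice `r ≤ s` contains its endpoint, so the half-open interval is first replaced by the
    -- closed one.
    rw [← intervalIntegral.integral_mul_const, intervalIntegral.integral_of_le hT,
      intervalIntegral.integral_of_le hr.2, ← integral_Icc_eq_integral_Ioc (x := r),
      ← integral_indicator measurableSet_Ioc, ← integral_indicator measurableSet_Icc]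
    congr 1; ext s
    have : r ≤ s → 0 < s := fun h => hr.1.trans_le h
    simp only [indicator, mem_Ioc, mem_Icc, mem_ofPred_eq]
    grind
  rw [← intervalIntegral.integral_congr e1, hswap]
  exact intervalIntegral.integral_congr_ae (Filter.Eventually.of_forall e2)

/-- Moves a primitive from the kernel to the path, by Fubini on the triangle. Since `y` vanishes at
nonpositive times, the inner integral of `y (t - s)` over `[r, T]` is the primitive of `y` at `t -
r`. -/
theorem causalConv_primitive {T : ℝ} {m : ℝ → ℂ} (hm : IntervalIntegrable m volume 0 T)
    {y : ℝ → ℂ} (hy : Continuous y) (hy0 : ∀ t ≤ 0, y t = 0) {t : ℝ} (ht : t ∈ Icc 0 T) :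
    causalConv T (fun r => ∫ ρ in (0 : ℝ)..r, m ρ) y t =
      causalConv T m (fun t => ∫ r in (0 : ℝ)..t, y r) t := by
  have hT : 0 ≤ T := ht.1.trans ht.2
  have := integral_mul_primitive_eq hT (p := fun r => y (t - r))
    (Continuous.intervalIntegrable (by fun_prop) _ _) hm
  simp only [causalConv, smul_eq_mul]
  simp only [mul_comm _ (y _)]
  rw [this]
  refine intervalIntegral.integral_congr fun r hr => ?_
  rw [mul_comm, intervalIntegral.integral_comp_sub_left,
    ← intervalIntegral.integral_interval_sub_left (hy.intervalIntegrable 0 _)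
    (hy.intervalIntegrable 0 _), integral_of_nonpos hy0 (t := t - T) (by linarith [ht.2]), sub_zero]

/-- Integration by parts: multiplying a primitive by an exponential. -/
theorem cexp_mul_primitive {T : ℝ} (α C : ℂ) {p : ℝ → ℂ} (hp : IntervalIntegrable p volume 0 T)
    {t : ℝ} (ht : t ∈ Icc 0 T) :
    Complex.exp (α * t) * (C + ∫ s in (0 : ℝ)..t, p s) =
      C + ∫ s in (0 : ℝ)..t, Complex.exp (α * s) * (p s + α * (C + ∫ r in (0 : ℝ)..s, p r)) := by
  have hpt : IntervalIntegrable p volume 0 t := hp.mono_set (by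
    rw [uIcc_of_le ht.1, uIcc_of_le (ht.1.trans ht.2)]; exact Icc_subset_Icc_right ht.2)
  have hder : ∀ s : ℝ, HasDerivAt (fun s : ℝ => Complex.exp (α * s)) (α * Complex.exp (α * s)) s :=
    fun s => by
      have := (((Complex.ofRealCLM.hasDerivAt (x := s)).const_mul α).cexp)
      simpa [mul_comm] using this
  have hc : Continuous fun s : ℝ => α * Complex.exp (α * s) := by fun_prop
  have hE : ∀ a b : ℝ, ∫ s in a..b, α * Complex.exp (α * s) =
      Complex.exp (α * b) - Complex.exp (α * a) := fun a b =>
    intervalIntegral.integral_eq_sub_of_hasDerivAt (fun s _ => hder s) (hc.intervalIntegrable _ _)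
  have hF := integral_mul_primitive_eq ht.1 (hc.intervalIntegrable 0 t) hpt
  simp only [hE, sub_mul] at hF
  have hprim : ContinuousOn (fun s => ∫ r in (0 : ℝ)..s, p r) (uIcc 0 t) :=
    intervalIntegral.continuousOn_primitive_interval' hpt left_mem_uIcc
  have i1 : IntervalIntegrable (fun s : ℝ => Complex.exp (α * s) * p s) volume 0 t :=
    hpt.continuousOn_mul (by fun_prop)
  have i2 : IntervalIntegrable (fun s : ℝ => α * Complex.exp (α * s) * ∫ r in (0 : ℝ)..s, p r)
      volume 0 t := ContinuousOn.intervalIntegrable (by fun_prop)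
  have i3 : IntervalIntegrable (fun s : ℝ => C * (α * Complex.exp (α * s))) volume 0 t :=
    Continuous.intervalIntegrable (by fun_prop) _ _
  rw [intervalIntegral.integral_sub (hpt.const_mul _) i1,
    intervalIntegral.integral_const_mul] at hF
  have : ∀ s : ℝ, Complex.exp (α * s) * (p s + α * (C + ∫ r in (0 : ℝ)..s, p r)) =
      Complex.exp (α * s) * p s + α * Complex.exp (α * s) * (∫ r in (0 : ℝ)..s, p r)
        + C * (α * Complex.exp (α * s)) := fun s => by ring
  simp only [this]
  rw [intervalIntegral.integral_add (i1.add i2) i3, intervalIntegral.integral_add i1 i2,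
    intervalIntegral.integral_const_mul, hE, hF]
  simp
  ring

/-- Variation of constants for `x'' + μ x = a + ∫ K`, in terms of `ξ = x'`. -/
theorem IsMode.eq_of_integral_eq {μ : ℝ} {s c : ℝ → ℂ} (h : IsMode μ s c) {ξ K : ℝ → ℂ}
    (hξ : Continuous ξ) (hK : Continuous K) (a : ℂ) {t : ℝ} (ht : 0 ≤ t)
    (heq : ∀ r ∈ Icc 0 t, ξ r = ∫ τ in (0 : ℝ)..r,
      (-(μ : ℂ) * (∫ ρ in (0 : ℝ)..τ, ξ ρ) + a + ∫ ρ in (0 : ℝ)..τ, K ρ)) :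
    ξ t = a * s t + ∫ τ in (0 : ℝ)..t, s (t - τ) * K τ := by
  have hX := continuous_primitive_of_continuous hξ
  have hJ := continuous_primitive_of_continuous hK
  set X : ℝ → ℂ := fun τ => ∫ ρ in (0 : ℝ)..τ, ξ ρ with hXdef
  set L : ℝ → ℂ := fun τ => ∫ ρ in (0 : ℝ)..τ, K ρ with hLdef
  have hXd : ∀ τ, HasDerivAt X (ξ τ) τ := fun τ => hξ.integral_hasStrictDerivAt 0 τ |>.hasDerivAt
  have hLd : ∀ τ, HasDerivAt L (K τ) τ := fun τ => hK.integral_hasStrictDerivAt 0 τ |>.hasDerivAt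
  have hFc : Continuous fun τ => -(μ : ℂ) * X τ + a + L τ := by fun_prop
  set Ξ : ℝ → ℂ := fun r => ∫ τ in (0 : ℝ)..r, (-(μ : ℂ) * X τ + a + L τ) with hΞdef
  have hΞd : ∀ τ, HasDerivAt Ξ (-(μ : ℂ) * X τ + a + L τ) τ :=
    fun τ => hFc.integral_hasStrictDerivAt 0 τ |>.hasDerivAt
  have hsd : ∀ τ, HasDerivAt (fun τ => s (t - τ)) (-c (t - τ)) τ := fun τ => by
    simpa using (h.hasDerivAt (t - τ)).comp_const_sub t τ
  have hcd : ∀ τ, HasDerivAt (fun τ => c (t - τ)) (μ * s (t - τ)) τ := fun τ => by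
    simpa using (h.hasDerivAt' (t - τ)).comp_const_sub t τ
  -- The function is an explicit antiderivative of `s (t - τ) * K τ`: differentiating leaves the
  -- extra term `μ s (t - τ) (Ξ - ξ)`, which vanishes by the equation. Its values are `ξ t` at `τ =
  -- t` and `a * s t` at `τ = 0`.
  have hD : ∀ τ ∈ uIcc 0 t, HasDerivAt
      (fun τ => c (t - τ) * Ξ τ - μ * (s (t - τ) * X τ) + s (t - τ) * (a + L τ))
      (s (t - τ) * K τ) τ := fun τ hτ => by
    rw [uIcc_of_le ht] at hτ
    have := (((hcd τ).mul (hΞd τ)).sub (((hsd τ).mul (hXd τ)).const_mul (μ : ℂ))).add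
      ((hsd τ).mul ((hLd τ).const_add a))
    refine this.congr_deriv ?_
    rw [show Ξ τ = ξ τ from (heq τ hτ).symm]
    ring
  have hs := h.continuous
  have hfin := intervalIntegral.integral_eq_sub_of_hasDerivAt hD
    (Continuous.intervalIntegrable (by fun_prop) _ _)
  rw [hfin, heq t ⟨ht, le_rfl⟩]
  have h0 : L 0 = 0 := by simp [hLdef]
  have h1 : X 0 = 0 := by simp [hXdef]
  have h2 : Ξ 0 = 0 := by simp [hΞdef]
  simp only [sub_self, h.zero, h.one, sub_zero, h0, h1, h2]
  change Ξ t = _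
  ring

/-! ### Reduction of the scalar viscoelastic equations. -/

/-- The integral equation, free of `μ` except through `s`, that is satisfied by a mode `y` of the
viscoelastic equation after the term `N(0) y` has been removed by an exponential factor. -/
structure IsReducedMode (T : ℝ) (N m S : ℝ → ℂ) (κ σ₀ : ℂ) (s : ℝ → ℂ) (f : ℂ) (y : ℝ → ℂ) : Prop where
  continuous : Continuous y
  of_nonpos : ∀ t ≤ 0, y t = 0
  eq : ∀ t ∈ Icc 0 T, y t = causalConv T N y t + σ₀ * f * s t +
    ∫ τ in (0 : ℝ)..t, s (t - τ) * (f * S τ - κ * y τ - causalConv T m y τ)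

theorem causalConv_congr {T : ℝ} (hT : 0 ≤ T) {p q y : ℝ → ℂ} (h : ∀ t ∈ Icc 0 T, p t = q t)
    (t : ℝ) : causalConv T p y t = causalConv T q y t := by
  refine intervalIntegral.integral_congr fun r hr => ?_
  rw [uIcc_of_le hT] at hr
  simp only [h r hr]

theorem causalConv_const_add {T : ℝ} (hT : 0 ≤ T) (a : ℂ) {p : ℝ → ℂ}
    (hp : IntervalIntegrable p volume 0 T) {y : ℝ → ℂ} (hy : Continuous y)
    (hy0 : ∀ t ≤ 0, y t = 0) {t : ℝ} (ht : t ∈ Icc 0 T) :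
    causalConv T (fun r => a + p r) y t = a * (∫ r in (0 : ℝ)..t, y r) + causalConv T p y t := by
  have h1 := causalConv_eq' hT ht (intervalIntegrable_const (c := a) (μ := volume)) hy hy0
  simp only [smul_eq_mul, intervalIntegral.integral_const_mul] at h1
  rw [← h1]
  simp only [causalConv, add_smul]
  exact intervalIntegral.integral_add
    (intervalIntegrable_smul_comp_sub intervalIntegrable_const hy t 0 T)
    (intervalIntegrable_smul_comp_sub hp hy t 0 T)

theorem intervalIntegrable_primitive {T : ℝ} {m : ℝ → ℂ} (hm : IntervalIntegrable m volume 0 T) :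
    IntervalIntegrable (fun t => ∫ r in (0 : ℝ)..t, m r) volume 0 T :=
  (intervalIntegral.continuousOn_primitive_interval' hm left_mem_uIcc).intervalIntegrable

/-- Both terms with factor `μ` are carried by `ξ = y - N * y`, because `∫ ξ = ∫ y - N * ∫ y`.
Differentiating `N * y` produces `n₀ y + d ∫ y + m * ∫ y`: its first term cancels the `n₀ y` of the
equation, and the other two are primitives, so they join the forcing `K`. -/
theorem IsMode.isReduced {μ : ℝ} {s c : ℝ → ℂ} (h : IsMode μ s c) {T : ℝ} (hT : 0 ≤ T)
    {N m S σ : ℝ → ℂ} {n₀ d σ₀ κ f : ℂ} (hm : IntervalIntegrable m volume 0 T)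
    (hN : ∀ t ∈ Icc 0 T, N t = n₀ + ∫ s in (0 : ℝ)..t, (d + ∫ r in (0 : ℝ)..s, m r))
    (hS : Continuous S) (hσ : ∀ t ∈ Icc 0 T, σ t = σ₀ + ∫ s in (0 : ℝ)..t, S s)
    {y : ℝ → ℂ} (hy : Continuous y) (hy0 : ∀ t ≤ 0, y t = 0)
    (heq : ∀ t ∈ Icc 0 T, y t = ∫ τ in (0 : ℝ)..t, (-(μ : ℂ) * (∫ r in (0 : ℝ)..τ, y r)
      + μ * causalConv T N (fun τ => ∫ r in (0 : ℝ)..τ, y r) τ + σ τ * f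
      + n₀ * y τ - κ * ∫ r in (0 : ℝ)..τ, y r)) :
    IsReducedMode T N m S (κ + d) σ₀ s f y := by
  refine ⟨hy, hy0, fun t ht => ?_⟩
  have hJ := continuous_primitive_of_continuous hy
  have hJ0 := fun t ht => integral_of_nonpos hy0 (t := t) ht
  have hm1 := intervalIntegrable_primitive hm
  have hp : IntervalIntegrable (fun s => d + ∫ r in (0 : ℝ)..s, m r) volume 0 T :=
    intervalIntegrable_const.add hm1
  have hNint : IntervalIntegrable N volume 0 T := by
    refine (intervalIntegrable_const.add (intervalIntegrable_primitive hp)).congr_ae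
      (f := fun t => n₀ + ∫ s in (0 : ℝ)..t, (d + ∫ r in (0 : ℝ)..s, m r)) ?_
    refine (ae_restrict_mem measurableSet_uIoc).mono fun r hr => ?_
    rw [uIoc_of_le hT] at hr
    exact (hN r (Ioc_subset_Icc_self hr)).symm
  have hVm := continuous_causalConv hm hy
  have hVN := continuous_causalConv hNint hy
  have hVNJ := continuous_causalConv hNint hJ
  have hVmJ := continuous_causalConv hm hJ
  have hNy : ∀ r ∈ Icc 0 T, causalConv T N y r = ∫ τ in (0 : ℝ)..r,
      (n₀ * y τ + d * (∫ r in (0 : ℝ)..τ, y r) + ∫ ρ in (0 : ℝ)..τ, causalConv T m y ρ) := by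
    intro r hr
    rw [causalConv_congr hT hN, causalConv_const_add hT _ (intervalIntegrable_primitive hp) hy hy0 hr,
      causalConv_primitive hp hy hy0 hr, causalConv_const_add hT _ hm1 hJ hJ0 hr,
      causalConv_primitive hm hJ hJ0 hr, ← integral_causalConv hT hm hJ hJ0]
    simp only [integral_causalConv hT hm hy hy0]
    rw [intervalIntegral.integral_add, intervalIntegral.integral_add,
      intervalIntegral.integral_const_mul, intervalIntegral.integral_const_mul]
    · ring
    all_goals exact Continuous.intervalIntegrable (by fun_prop) _ _
  have key := h.eq_of_integral_eq (ξ := fun τ => y τ - causalConv T N y τ)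
    (K := fun τ => f * S τ - (κ + d) * y τ - causalConv T m y τ) (by fun_prop) (by fun_prop)
    (σ₀ * f) ht.1 ?_
  · rw [add_assoc, ← key]; ring
  · intro r hr
    have hrT : r ∈ Icc 0 T := ⟨hr.1, hr.2.trans ht.2⟩
    rw [heq r hrT, hNy r hrT, ← intervalIntegral.integral_sub]
    · refine intervalIntegral.integral_congr fun τ hτ => ?_
      rw [uIcc_of_le hr.1] at hτ
      have hτT : τ ∈ Icc 0 T := ⟨hτ.1, hτ.2.trans hrT.2⟩
      rw [hσ τ hτT, intervalIntegral.integral_sub, integral_causalConv hT hNint hy hy0,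
        intervalIntegral.integral_sub, intervalIntegral.integral_sub,
        intervalIntegral.integral_const_mul, intervalIntegral.integral_const_mul]
      · ring
      all_goals exact Continuous.intervalIntegrable (by fun_prop) _ _
    · have : ContinuousOn σ (uIcc 0 r) := by
        refine ContinuousOn.congr (f := fun t => σ₀ + ∫ s in (0 : ℝ)..t, S s) ?_ ?_
        · have := continuous_primitive_of_continuous hS
          fun_prop
        · intro x hx
          rw [uIcc_of_le hr.1] at hx
          exact hσ x ⟨hx.1, hx.2.trans hrT.2⟩
      exact ContinuousOn.intervalIntegrable (by fun_prop)
    · have := continuous_primitive_of_continuous hVm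
      exact Continuous.intervalIntegrable (by fun_prop) _ _

/-- The scalar equation satisfied by the coefficient of a source solution at an eigenvector with
eigenvalue `μ`. -/
def IsScalarSourceSolution (T : ℝ) (M σ : ℝ → ℂ) (μ : ℝ) (f : ℂ) (z z' : ℝ → ℂ) : Prop :=
  z 0 = 0 ∧ z' 0 = 0 ∧ ∀ t ∈ Icc (0 : ℝ) T, HasDerivWithinAt z (z' t) (Icc 0 T) t ∧
    HasDerivWithinAt z' (-(μ * z t) + (∫ s in (0 : ℝ)..t, M (t - s) * (μ * z s)) + σ t * f)
      (Icc 0 T) t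

theorem exists_continuous_extension {E : Type*} [TopologicalSpace E] {T : ℝ} (hT : 0 ≤ T)
    {w : ℝ → E} (hw : ContinuousOn w (Icc 0 T)) :
    ∃ y : ℝ → E, Continuous y ∧ (∀ t ∈ Icc 0 T, y t = w t) ∧ ∀ t ≤ 0, y t = w 0 :=
  ⟨IccExtend hT ((Icc 0 T).domRestrict w), hw.domRestrict.Icc_extend', fun t ht => by
    rw [IccExtend_of_mem _ _ ht]; rfl, fun t ht => by rw [IccExtend_of_le_left _ _ ht]; rfl⟩

theorem sub_eq_integral_of_hasDerivWithinAt {E : Type*} [NormedAddCommGroup E] [NormedSpace ℝ E]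
    [CompleteSpace E] {T : ℝ} {w w' : ℝ → E}
    (h : ∀ t ∈ Icc 0 T, HasDerivWithinAt w (w' t) (Icc 0 T) t)
    (hw' : ContinuousOn w' (Icc 0 T)) {t : ℝ} (ht : t ∈ Icc 0 T) :
    w t - w 0 = ∫ s in (0 : ℝ)..t, w' s := by
  have hsub : Icc 0 t ⊆ Icc 0 T := Icc_subset_Icc_right ht.2
  refine (intervalIntegral.integral_eq_sub_of_hasDerivAt_of_le ht.1
    (fun s hs => ((h s (hsub hs)).continuousWithinAt).mono hsub) (fun s hs => ?_) ?_).symm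
  · exact (h s (hsub (Ioo_subset_Icc_self hs))).hasDerivAt
      (Icc_mem_nhds hs.1 (hs.2.trans_le ht.2))
  · exact (hw'.mono (by rw [uIcc_of_le ht.1]; exact hsub)).intervalIntegrable

theorem hasDerivAt_cexp_mul (α : ℂ) (t : ℝ) :
    HasDerivAt (fun t : ℝ => Complex.exp (α * t)) (α * Complex.exp (α * t)) t := by
  simpa [mul_comm] using ((Complex.ofRealCLM.hasDerivAt (x := t)).const_mul α).cexp

/-- Two applications of `cexp_mul_primitive` keep the form of a twofold primitive after
multiplication by the exponential. The continuous representative `M'` supplies a value at `0`. -/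
theorem exists_exp_memH2 {T : ℝ} (hT : 0 < T) {M : ℝ → ℂ} (hM : MemH2 T M) :
    ∃ (M' : ℝ → ℂ) (α d : ℂ) (m : ℝ → ℂ), IntervalIntegrable m volume 0 T ∧
      ContinuousOn M' (Icc 0 T) ∧ (∀ᵐ t ∂(volume.restrict (Icc (0 : ℝ) T)), M t = M' t) ∧
      ∀ t ∈ Icc 0 T, Complex.exp (α * t) * M' t =
        2 * α + ∫ s in (0 : ℝ)..t, (d + ∫ r in (0 : ℝ)..s, m r) := by
  obtain ⟨c₀, c₁, M₂, hM₂, hae⟩ := hM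
  have h2 : IntervalIntegrable M₂ volume 0 T := by
    rw [intervalIntegrable_iff_integrableOn_Icc_of_le hT.le]
    exact hM₂.integrable (by norm_num)
  have h1 : IntervalIntegrable (fun s => c₁ + ∫ r in (0 : ℝ)..s, M₂ r) volume 0 T :=
    intervalIntegrable_const.add (intervalIntegrable_primitive h2)
  set M₁ : ℝ → ℂ := fun s => c₁ + ∫ r in (0 : ℝ)..s, M₂ r with hM₁
  set M₀ : ℝ → ℂ := fun t => c₀ + ∫ s in (0 : ℝ)..t, M₁ s with hM₀
  have hM₀c : ContinuousOn M₀ (uIcc 0 T) :=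
    continuousOn_const.add (intervalIntegral.continuousOn_primitive_interval' h1 left_mem_uIcc)
  -- The exponential change of unknown creates a first-order term with coefficient `2 α`; this
  -- choice makes it equal to the initial value `c₀` of the kernel, as the later cancellation
  -- requires.
  set α : ℂ := c₀ / 2
  have h3 : IntervalIntegrable (fun s => M₂ s + α * M₁ s) volume 0 T := h2.add (h1.const_mul α)
  refine ⟨M₀, α, c₁ + α * c₀, fun s => Complex.exp (α * s) * ((M₂ s + α * M₁ s) + α *
    ((c₁ + α * c₀) + ∫ r in (0 : ℝ)..s, (M₂ r + α * M₁ r))), ?_, ?_, hae, fun t ht => ?_⟩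
  · exact (h3.add ((intervalIntegrable_const.add (intervalIntegrable_primitive h3)).const_mul
      α)).continuousOn_mul (by fun_prop)
  · rwa [uIcc_of_le hT.le] at hM₀c
  · rw [cexp_mul_primitive α c₀ h1 ht]
    congr 1
    · simp only [α]; ring
    refine intervalIntegral.integral_congr fun s hs => ?_
    rw [uIcc_of_le ht.1] at hs
    have hsT : s ∈ Icc 0 T := ⟨hs.1, hs.2.trans ht.2⟩
    have hsub : uIcc 0 s ⊆ uIcc 0 T := by
      rw [uIcc_of_le hs.1, uIcc_of_le hT.le]; exact Icc_subset_Icc_right hsT.2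
    rw [← cexp_mul_primitive α _ h3 hsT, intervalIntegral.integral_add (h2.mono_set hsub)
      ((h1.mono_set hsub).const_mul α), intervalIntegral.integral_const_mul]
    simp only [hM₁]
    ring

/-- The reduction of the scalar viscoelastic equations, for all eigenvalues simultaneously, to
integral equations whose kernels do not depend on the eigenvalue. -/
theorem exists_isReducedMode {T : ℝ} (hT : 0 < T) {M σ : ℝ → ℂ} (hM : MemH2 T M)
    (hσ : ContDiffOn ℝ 1 σ (Icc 0 T)) :
    ∃ (α κ : ℂ) (N m S : ℝ → ℂ), Continuous S ∧ Continuous N ∧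
      IntervalIntegrable m volume 0 T ∧
      ∀ (μ : ℝ) (s c : ℝ → ℂ), IsMode μ s c → ∀ (f : ℂ) (z z' : ℝ → ℂ),
        IsScalarSourceSolution T M σ μ f z z' → ∃ y : ℝ → ℂ,
          IsReducedMode T N m S κ (σ 0) s f y ∧
          ∀ t ∈ Icc 0 T, z' t = Complex.exp (-α * t) * (y t - α * ∫ r in (0 : ℝ)..t, y r) := by
  obtain ⟨M', α, d, m, hm, hM'c, hae, hM'⟩ := exists_exp_memH2 hT hM
  have hσd : ∀ t ∈ Icc 0 T, HasDerivWithinAt σ (derivWithin σ (Icc 0 T) t) (Icc 0 T) t :=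
    fun t ht => (hσ.differentiableOn one_ne_zero t ht).hasDerivWithinAt
  have hσ'c := hσ.continuousOn_derivWithin (uniqueDiffOn_Icc hT) le_rfl
  have hσc := hσ.continuousOn
  obtain ⟨S, hS, hSeq, -⟩ := exists_continuous_extension hT.le
    (w := fun t => α * Complex.exp (α * t) * σ t +
      Complex.exp (α * t) * derivWithin σ (Icc 0 T) t) (by fun_prop)
  obtain ⟨N, hN, hNeq, -⟩ := exists_continuous_extension hT.le
    (w := fun t => Complex.exp (α * t) * M' t) (by fun_prop)
  refine ⟨α, α ^ 2 + d, N, m, S, hS, hN, hm, fun μ s c hsc f z z' ⟨hz0, hz'0, hz⟩ => ?_⟩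
  have hzc : ContinuousOn z (Icc 0 T) := fun t ht => (hz t ht).1.continuousWithinAt
  have hz'c : ContinuousOn z' (Icc 0 T) := fun t ht => (hz t ht).2.continuousWithinAt
  -- Here `y` is the derivative of `exp(α t) z`. Its extension to negative times is constant, and
  -- the zero initial data make that constant zero.
  obtain ⟨y, hy, hyeq, hy0⟩ := exists_continuous_extension hT.le
    (w := fun t => Complex.exp (α * t) * (z' t + α * z t)) (by fun_prop)
  simp only [hz'0, hz0, mul_zero, add_zero] at hy0
  have hzy : ∀ t ∈ Icc 0 T, ∫ r in (0 : ℝ)..t, y r = Complex.exp (α * t) * z t := fun t ht => by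
    have := sub_eq_integral_of_hasDerivWithinAt (w := fun t => Complex.exp (α * t) * z t) (w' := y)
      (fun t ht => ((hasDerivAt_cexp_mul α t).hasDerivWithinAt.mul (hz t ht).1).congr_deriv
        (by rw [hyeq t ht]; ring)) hy.continuousOn ht
    simpa [hz0] using this.symm
  have hJ := continuous_primitive_of_continuous hy
  have hJ0 := fun t ht => integral_of_nonpos hy0 (t := t) ht
  have hNint := hN.intervalIntegrable (μ := volume) 0 T
  have hconv : ∀ t ∈ Icc 0 T, Complex.exp (α * t) * ∫ s in (0 : ℝ)..t, M (t - s) * (μ * z s) =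
      μ * causalConv T N (fun τ => ∫ r in (0 : ℝ)..τ, y r) t := fun t ht => by
    have e1 : ∫ s in (0 : ℝ)..t, M (t - s) * (μ * z s) =
        ∫ s in (0 : ℝ)..t, M s * (μ * z (t - s)) := by
      have := intervalIntegral.integral_comp_sub_left (a := 0) (b := t)
        (fun s => M s * (μ * z (t - s))) t
      simpa using this
    have e2 : ∫ s in (0 : ℝ)..t, M s * (μ * z (t - s)) =
        ∫ s in (0 : ℝ)..t, M' s * (μ * z (t - s)) := by
      refine intervalIntegral.integral_congr_ae ?_
      filter_upwards [(ae_restrict_iff' measurableSet_Icc).1 hae] with s hs hst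
      rw [uIoc_of_le ht.1] at hst
      rw [hs ⟨hst.1.le, hst.2.trans ht.2⟩]
    rw [e1, e2, causalConv_eq hT.le ht hNint hJ hJ0, ← intervalIntegral.integral_const_mul,
      ← intervalIntegral.integral_const_mul]
    refine intervalIntegral.integral_congr fun s hs => ?_
    rw [uIcc_of_le ht.1] at hs
    rw [hNeq s ⟨hs.1, hs.2.trans ht.2⟩, hzy (t - s) ⟨by linarith [hs.2], by linarith [hs.1, ht.2]⟩,
      smul_eq_mul, show α * (t : ℂ) = α * s + α * ((t - s : ℝ) : ℂ) by push_cast; ring,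
      Complex.exp_add]
    ring
  refine ⟨y, hsc.isReduced hT.le (n₀ := 2 * α) (σ := fun t => Complex.exp (α * t) * σ t) hm
    (fun t ht => (hNeq t ht).trans (hM' t ht)) hS (fun t ht => ?_) hy hy0 (fun t ht => ?_),
    fun t ht => ?_⟩
  · have := sub_eq_integral_of_hasDerivWithinAt (w := fun t => Complex.exp (α * t) * σ t) (w' := S)
      (fun t ht => ((hasDerivAt_cexp_mul α t).hasDerivWithinAt.mul (hσd t ht)).congr_deriv
        (by rw [hSeq t ht])) hS.continuousOn ht
    rw [← this]; simp
  · have hVc := continuous_causalConv hNint hJ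
    have := sub_eq_integral_of_hasDerivWithinAt
      (w := fun t => Complex.exp (α * t) * (z' t + α * z t))
      (w' := fun τ => -(μ : ℂ) * (∫ r in (0 : ℝ)..τ, y r)
        + μ * causalConv T N (fun τ => ∫ r in (0 : ℝ)..τ, y r) τ + Complex.exp (α * τ) * σ τ * f
        + 2 * α * y τ - α ^ 2 * ∫ r in (0 : ℝ)..τ, y r)
      (fun t ht => ((hasDerivAt_cexp_mul α t).hasDerivWithinAt.mul
        ((hz t ht).2.add ((hz t ht).1.const_mul α))).congr_deriv ?_) (by fun_prop) ht
    · rw [← this, hyeq t ht]; simp [hz0, hz'0]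
    · rw [← hconv t ht, hyeq t ht, hzy t ht]
      simp only [Pi.add_apply]
      ring
  · rw [hyeq t ht, hzy t ht]
    have : Complex.exp (-α * t) * Complex.exp (α * t) = 1 := by
      rw [← Complex.exp_add]; simp
    linear_combination (-z' t) * this

/-! ### Uniform estimates for finite sums of modes. -/

/-- A family of modes together with solutions of the corresponding reduced equations. -/
structure IsReducedFamily {ι : Type*} (T : ℝ) (N m S : ℝ → ℂ) (κ σ₀ : ℂ) (s : ι → ℝ → ℂ)
    (f : ι → ℂ) (y : ι → ℝ → ℂ) : Prop where
  mode : ∀ i, ∃ (μ : ℝ) (c : ℝ → ℂ), IsMode μ (s i) c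
  reduced : ∀ i, IsReducedMode T N m S κ σ₀ (s i) (f i) (y i)

section

variable {ι G : Type*} [NormedAddCommGroup G] [NormedSpace ℂ G] [CompleteSpace G]

theorem causalConv_sum {T : ℝ} {p : ℝ → ℂ} (hp : IntervalIntegrable p volume 0 T)
    (F : Finset ι) {y : ι → ℝ → ℂ} (hy : ∀ i, Continuous (y i)) (v : ι → G) (t : ℝ) :
    causalConv T p (fun t => ∑ i ∈ F, y i t • v i) t = ∑ i ∈ F, causalConv T p (y i) t • v i := by
  simp only [causalConv, Finset.smul_sum, smul_eq_mul, ← mul_smul]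
  rw [intervalIntegral.integral_finsetSum]
  · exact Finset.sum_congr rfl fun i _ => intervalIntegral.integral_smul_const _ _
  · intro i _
    have := intervalIntegrable_smul_comp_sub hp (hy i) t 0 T
    exact ⟨this.1.smul_const _, this.2.smul_const _⟩

omit [CompleteSpace G] in
theorem norm_causalConv_le {T : ℝ} (hT : 0 ≤ T) {p : ℝ → ℂ} (hp : IntervalIntegrable p volume 0 T)
    {y : ℝ → G} (hy0 : ∀ t ≤ 0, y t = 0) {t : ℝ} (ht : t ∈ Icc 0 T) {b : ℝ}
    (hb : ∀ r ∈ Icc 0 t, ‖y r‖ ≤ b) : ‖causalConv T p y t‖ ≤ (∫ r in (0 : ℝ)..T, ‖p r‖) * b := by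
  have hb0 : 0 ≤ b := (norm_nonneg _).trans (hb 0 ⟨le_rfl, ht.1⟩)
  rw [causalConv, ← intervalIntegral.integral_mul_const]
  refine intervalIntegral.norm_integral_le_of_norm_le hT (Filter.Eventually.of_forall fun r hr => ?_)
    (hp.norm.mul_const b)
  rw [norm_smul]
  refine mul_le_mul_of_nonneg_left ?_ (norm_nonneg _)
  rcases le_or_gt (t - r) 0 with h | h
  · simpa [hy0 _ h] using hb0
  · exact hb _ ⟨h.le, by linarith [hr.1]⟩

omit [CompleteSpace G] in
theorem norm_causalConv_le' {T : ℝ} (hT : 0 ≤ T) {p : ℝ → ℂ} (hp : Continuous p) {C : ℝ}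
    (hC : ∀ r ∈ Icc 0 T, ‖p r‖ ≤ C) {y : ℝ → G} (hy : Continuous y) (hy0 : ∀ t ≤ 0, y t = 0)
    {t : ℝ} (ht : t ∈ Icc 0 T) : ‖causalConv T p y t‖ ≤ C * ∫ r in (0 : ℝ)..t, ‖y r‖ := by
  rw [causalConv_eq' hT ht (hp.intervalIntegrable _ _) hy hy0,
    ← intervalIntegral.integral_const_mul]
  refine intervalIntegral.norm_integral_le_of_norm_le ht.1
    (Filter.Eventually.of_forall fun r hr => ?_)
    (Continuous.intervalIntegrable (by fun_prop) _ _)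
  rw [norm_smul]
  exact mul_le_mul_of_nonneg_right (hC _ ⟨by linarith [hr.2], by linarith [hr.1, ht.2]⟩)
    (norm_nonneg _)

variable {T : ℝ} {N m S : ℝ → ℂ} {κ σ₀ : ℂ} {s : ι → ℝ → ℂ} {f : ι → ℂ} {y : ι → ℝ → ℂ}

namespace IsReducedFamily

theorem continuous_mode (h : IsReducedFamily T N m S κ σ₀ s f y) (i : ι) : Continuous (s i) := by
  obtain ⟨_, _, hm⟩ := h.mode i
  exact hm.continuous

/-- The limits in the product formula do not depend on the mode, so a sum with two mode factors is
an average of sums with one. This is what makes estimates uniform in the eigenvalues possible. -/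
theorem sum_mul_eq (h : IsReducedFamily T N m S κ σ₀ s f y) (F : Finset ι) (x : ι → ℂ) (b : ι → G)
    (a t : ℝ) : ∑ i ∈ F, (x i * s i t) • (s i a • b i) =
      (1 / 2 : ℂ) • ∫ q in |a - t|..(a + t), ∑ i ∈ F, x i • (s i q • b i) := by
  rw [intervalIntegral.integral_finsetSum, Finset.smul_sum]
  · refine Finset.sum_congr rfl fun i _ => ?_
    obtain ⟨_, _, hm⟩ := h.mode i
    simp only [smul_smul]
    rw [intervalIntegral.integral_smul_const, intervalIntegral.integral_const_mul, smul_smul,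
      mul_assoc, mul_comm (s i t), hm.mul_eq]
    congr 1; ring
  · intro i _
    have := h.continuous_mode i
    exact Continuous.intervalIntegrable (by fun_prop) _ _

/-- The coefficients `S`, `κ`, `m` are shared by all modes, so the forcing commutes with the
summation and acts on the variable `τ` only, with `q` frozen. -/
theorem norm_sum_kernel_le (h : IsReducedFamily T N m S κ σ₀ s f y) (hT : 0 ≤ T)
    (hm : IntervalIntegrable m volume 0 T) {CS : ℝ} (hCS : ∀ r ∈ Icc 0 T, ‖S r‖ ≤ CS)
    (F : Finset ι) (b : ι → G) {τ q Y : ℝ} (hτ : τ ∈ Icc 0 T)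
    (hY : ∀ r ∈ Icc 0 τ, ‖∑ i ∈ F, y i r • (s i q • b i)‖ ≤ Y) :
    ‖∑ i ∈ F, (f i * S τ - κ * y i τ - causalConv T m (y i) τ) • (s i q • b i)‖ ≤
      CS * ‖∑ i ∈ F, (f i * s i q) • b i‖ + (‖κ‖ + ∫ r in (0 : ℝ)..T, ‖m r‖) * Y := by
  have hyc : ∀ i, Continuous (y i) := fun i => (h.reduced i).continuous
  have hy0 : ∀ t ≤ 0, ∑ i ∈ F, y i t • (s i q • b i) = 0 := fun t ht =>
    Finset.sum_eq_zero fun i _ => by rw [(h.reduced i).of_nonpos t ht, zero_smul]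
  have e : ∑ i ∈ F, (f i * S τ - κ * y i τ - causalConv T m (y i) τ) • (s i q • b i) =
      S τ • ∑ i ∈ F, (f i * s i q) • b i - κ • ∑ i ∈ F, y i τ • (s i q • b i) -
        causalConv T m (fun t => ∑ i ∈ F, y i t • (s i q • b i)) τ := by
    rw [causalConv_sum hm F hyc, Finset.smul_sum, Finset.smul_sum, ← Finset.sum_sub_distrib,
      ← Finset.sum_sub_distrib]
    refine Finset.sum_congr rfl fun i _ => ?_
    module
  rw [e, add_mul, ← add_assoc]
  refine (norm_sub_le _ _).trans (add_le_add ((norm_sub_le _ _).trans (add_le_add ?_ ?_)) ?_)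
  · rw [norm_smul]; exact mul_le_mul_of_nonneg_right (hCS τ hτ) (norm_nonneg _)
  · rw [norm_smul]
    exact mul_le_mul_of_nonneg_left (hY τ ⟨hτ.1, le_rfl⟩) (norm_nonneg _)
  · exact norm_causalConv_le hT hm hy0 hτ hY

theorem continuous_kernel (h : IsReducedFamily T N m S κ σ₀ s f y)
    (hm : IntervalIntegrable m volume 0 T) (hS : Continuous S) (i : ι) :
    Continuous fun τ => f i * S τ - κ * y i τ - causalConv T m (y i) τ := by
  have := (h.reduced i).continuous
  have := continuous_causalConv hm this
  fun_prop

/-- Under a weighted bound on the two-parameter sums, the reduced equation and the product formula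
give an improved bound. -/
theorem norm_sum_mul_le (h : IsReducedFamily T N m S κ σ₀ s f y)
    (hN : Continuous N) (hm : IntervalIntegrable m volume 0 T) (hS : Continuous S) {CN CS : ℝ}
    (hCN : ∀ r ∈ Icc 0 T, ‖N r‖ ≤ CN) (hCS : ∀ r ∈ Icc 0 T, ‖S r‖ ≤ CS)
    (F : Finset ι) (b : ι → G) {R : ℝ} (hR : R ∈ Icc 0 T) {l Y : ℝ} (hl : 0 < l)
    (hY0 : 0 ≤ Y)
    (hY : ∀ t a, 0 ≤ t → 0 ≤ a → t + a ≤ R →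
      ‖∑ i ∈ F, y i t • (s i a • b i)‖ ≤ Y * Real.exp (l * t))
    {t a : ℝ} (ht : 0 ≤ t) (ha : 0 ≤ a) (hta : t + a ≤ R) :
    ‖∑ i ∈ F, y i t • (s i a • b i)‖ ≤
      (CN + T * (‖κ‖ + ∫ r in (0 : ℝ)..T, ‖m r‖)) / l * (Y * Real.exp (l * t)) +
        (‖σ₀‖ + T * CS) * ∫ q in (0 : ℝ)..R, ‖∑ i ∈ F, (f i * s i q) • b i‖ := by
  have hT : 0 ≤ T := hR.1.trans hR.2
  have htT : t ∈ Icc 0 T := ⟨ht, by linarith [hR.2]⟩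
  have hyc : ∀ i, Continuous (y i) := fun i => (h.reduced i).continuous
  have hsc := h.continuous_mode
  have hKc := h.continuous_kernel hm hS
  have hCN0 : 0 ≤ CN := (norm_nonneg _).trans (hCN 0 ⟨le_rfl, hT⟩)
  have hCS0 : 0 ≤ CS := (norm_nonneg _).trans (hCS 0 ⟨le_rfl, hT⟩)
  set g : ℝ → G := fun q => ∑ i ∈ F, (f i * s i q) • b i with hg
  have hgc : Continuous g := by fun_prop
  set m₁ : ℝ := ∫ r in (0 : ℝ)..T, ‖m r‖ with hm₁
  have hm₁0 : 0 ≤ m₁ := intervalIntegral.integral_nonneg hT fun _ _ => norm_nonneg _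
  set I : ℝ := ∫ q in (0 : ℝ)..R, ‖g q‖ with hI
  have hI0 : 0 ≤ I := intervalIntegral.integral_nonneg hR.1 fun _ _ => norm_nonneg _
  have hsub : ∀ c d, 0 ≤ c → c ≤ d → d ≤ R → ∫ q in c..d, ‖g q‖ ≤ I := fun c d hc hcd hd =>
    intervalIntegral.integral_mono_interval hc hcd hd
      (Filter.Eventually.of_forall fun _ => norm_nonneg _) (hgc.norm.intervalIntegrable _ _)
  -- Integrating the weight gains the factor `1 / l`, the source of the later absorption.
  have hexp : ∫ τ in (0 : ℝ)..t, Real.exp (l * τ) ≤ Real.exp (l * t) / l := by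
    have h2 : ∫ τ in (0 : ℝ)..t, Real.exp (l * τ) = (Real.exp (l * t) - 1) / l := by
      rw [intervalIntegral.integral_comp_mul_left _ hl.ne', integral_exp]
      simp; ring
    rw [h2]
    gcongr
    linarith
  set K : ι → ℝ → ℂ := fun i τ => f i * S τ - κ * y i τ - causalConv T m (y i) τ with hK
  have hH : ∀ τ q, 0 ≤ τ → 0 ≤ q → τ + q ≤ R → ‖∑ i ∈ F, K i τ • (s i q • b i)‖ ≤
      CS * ‖g q‖ + (‖κ‖ + m₁) * (Y * Real.exp (l * τ)) := fun τ q hτ hq hτq =>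
    h.norm_sum_kernel_le hT hm hCS F b ⟨hτ, by linarith [hR.2]⟩ fun r hr =>
      (hY r q hr.1 hq (by linarith [hr.2])).trans (by
        have := hr.2
        gcongr)
  -- The reduced equation times `s i a`, with both mode products averaged. In the last integral `τ +
  -- q ≤ t + a`, so the arguments stay in the triangle where the bound `hY` is available.
  have e : ∑ i ∈ F, y i t • (s i a • b i) =
      causalConv T N (fun t => ∑ i ∈ F, y i t • (s i a • b i)) t +
      σ₀ • ((1 / 2 : ℂ) • ∫ q in |a - t|..(a + t), g q) +
      ∫ τ in (0 : ℝ)..t, ((1 / 2 : ℂ) • ∫ q in |a - (t - τ)|..(a + (t - τ)),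
        ∑ i ∈ F, K i τ • (s i q • b i)) := by
    simp only [hg, mul_smul]
    simp only [← h.sum_mul_eq]
    rw [causalConv_sum (hN.intervalIntegrable _ _) F hyc, intervalIntegral.integral_finsetSum,
      Finset.smul_sum, ← Finset.sum_add_distrib, ← Finset.sum_add_distrib]
    · refine Finset.sum_congr rfl fun i _ => ?_
      rw [intervalIntegral.integral_smul_const]
      simp only [mul_comm (K i _)]
      conv_lhs => rw [(h.reduced i).eq t htT]
      module
    · intro i _
      exact Continuous.intervalIntegrable (by fun_prop) _ _
  rw [e]
  have b1 : ‖causalConv T N (fun t => ∑ i ∈ F, y i t • (s i a • b i)) t‖ ≤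
      CN * (Y * (Real.exp (l * t) / l)) := by
    refine (norm_causalConv_le' hT hN hCN (by fun_prop) (fun t ht => Finset.sum_eq_zero fun i _ => by
      rw [(h.reduced i).of_nonpos t ht, zero_smul]) htT).trans ?_
    refine mul_le_mul_of_nonneg_left ?_ hCN0
    calc _ ≤ ∫ τ in (0 : ℝ)..t, Y * Real.exp (l * τ) := by
          refine intervalIntegral.integral_mono_on ht
            (Continuous.intervalIntegrable (by fun_prop) _ _)
            (Continuous.intervalIntegrable (by fun_prop) _ _) fun r hr => ?_
          exact hY r a hr.1 ha (by linarith [hr.2])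
      _ ≤ _ := by
          rw [intervalIntegral.integral_const_mul]
          exact mul_le_mul_of_nonneg_left hexp hY0
  have b2 : ‖σ₀ • ((1 / 2 : ℂ) • ∫ q in |a - t|..(a + t), g q)‖ ≤ ‖σ₀‖ * I := by
    rw [norm_smul, norm_smul]
    refine mul_le_mul_of_nonneg_left ?_ (norm_nonneg _)
    have h1 : |a - t| ≤ a + t := abs_le.2 ⟨by linarith, by linarith⟩
    have := (intervalIntegral.norm_integral_le_integral_norm (f := g) h1).trans
      (hsub _ _ (abs_nonneg _) h1 (by linarith))
    norm_num
    linarith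
  have b3 : ‖∫ τ in (0 : ℝ)..t, ((1 / 2 : ℂ) • ∫ q in |a - (t - τ)|..(a + (t - τ)),
        ∑ i ∈ F, K i τ • (s i q • b i))‖ ≤
      T * CS * I + T * (‖κ‖ + m₁) * (Y * (Real.exp (l * t) / l)) := by
    have hpt : ∀ τ ∈ Ioc 0 t, ‖((1 / 2 : ℂ) • ∫ q in |a - (t - τ)|..(a + (t - τ)),
        ∑ i ∈ F, K i τ • (s i q • b i))‖ ≤
        CS * I + T * ((‖κ‖ + m₁) * (Y * Real.exp (l * τ))) := fun τ hτ => by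
      have h0 : 0 ≤ t - τ := by linarith [hτ.2]
      have h1 : |a - (t - τ)| ≤ a + (t - τ) := abs_le.2 ⟨by linarith, by linarith⟩
      have h2 : ‖∫ q in |a - (t - τ)|..(a + (t - τ)), ∑ i ∈ F, K i τ • (s i q • b i)‖ ≤
          ∫ q in |a - (t - τ)|..(a + (t - τ)),
            (CS * ‖g q‖ + (‖κ‖ + m₁) * (Y * Real.exp (l * τ))) := by
        refine intervalIntegral.norm_integral_le_of_norm_le h1
          (Filter.Eventually.of_forall fun q hq => ?_)
          (Continuous.intervalIntegrable (by fun_prop) _ _)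
        exact hH τ q hτ.1.le ((abs_nonneg _).trans hq.1.le) (by linarith [hq.2])
      rw [intervalIntegral.integral_add (Continuous.intervalIntegrable (by fun_prop) _ _)
        intervalIntegrable_const, intervalIntegral.integral_const_mul,
        intervalIntegral.integral_const, smul_eq_mul] at h2
      have h3 := mul_le_mul_of_nonneg_left (hsub _ _ (abs_nonneg (a - (t - τ))) h1
        (by linarith [hτ.1])) hCS0
      have h4 : (a + (t - τ) - |a - (t - τ)|) * ((‖κ‖ + m₁) * (Y * Real.exp (l * τ))) ≤
          T * ((‖κ‖ + m₁) * (Y * Real.exp (l * τ))) := by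
        refine mul_le_mul_of_nonneg_right ?_ (by positivity)
        linarith [hτ.1, abs_nonneg (a - (t - τ)), hR.2]
      rw [norm_smul]
      have h5 := h2.trans (add_le_add h3 h4)
      have h6 := norm_nonneg (∫ q in |a - (t - τ)|..(a + (t - τ)), ∑ i ∈ F, K i τ • (s i q • b i))
      norm_num
      linarith
    have := intervalIntegral.norm_integral_le_of_norm_le ht (μ := volume)
      (Filter.Eventually.of_forall hpt) (Continuous.intervalIntegrable (by fun_prop) _ _)
    refine this.trans ?_
    rw [intervalIntegral.integral_add intervalIntegrable_const
      (Continuous.intervalIntegrable (by fun_prop) _ _), intervalIntegral.integral_const_mul,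
      intervalIntegral.integral_const_mul, intervalIntegral.integral_const_mul,
      intervalIntegral.integral_const, intervalIntegral.integral_const_mul, sub_zero, smul_eq_mul]
    have q1 := mul_le_mul_of_nonneg_right htT.2 (mul_nonneg hCS0 hI0)
    have q2 : T * ((‖κ‖ + m₁) * (Y * ∫ τ in (0 : ℝ)..t, Real.exp (l * τ))) ≤
      T * ((‖κ‖ + m₁) * (Y * (Real.exp (l * t) / l))) := by gcongr
    linarith
  refine (norm_add_le _ _).trans ((add_le_add ((norm_add_le _ _).trans (add_le_add b1 b2)) b3).trans
    (le_of_eq ?_))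
  field_simp
  ring

/-- The two-parameter sums are controlled by the `L¹` norm of the wave observation. -/
theorem norm_sum_mul_le_integral (h : IsReducedFamily T N m S κ σ₀ s f y)
    (hN : Continuous N) (hm : IntervalIntegrable m volume 0 T) (hS : Continuous S) {CN CS : ℝ}
    (hCN : ∀ r ∈ Icc 0 T, ‖N r‖ ≤ CN) (hCS : ∀ r ∈ Icc 0 T, ‖S r‖ ≤ CS)
    {l : ℝ} (hl : l = 2 * (CN + T * (‖κ‖ + ∫ r in (0 : ℝ)..T, ‖m r‖)) + 1)
    (F : Finset ι) (b : ι → G) {R : ℝ} (hR : R ∈ Icc 0 T)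
    {t a : ℝ} (ht : 0 ≤ t) (ha : 0 ≤ a) (hta : t + a ≤ R) :
    ‖∑ i ∈ F, y i t • (s i a • b i)‖ ≤ 2 * (‖σ₀‖ + T * CS) * Real.exp (l * T) *
      ∫ q in (0 : ℝ)..R, ‖∑ i ∈ F, (f i * s i q) • b i‖ := by
  have hT : 0 ≤ T := hR.1.trans hR.2
  have hyc : ∀ i, Continuous (y i) := fun i => (h.reduced i).continuous
  have hsc := h.continuous_mode
  have hCN0 : 0 ≤ CN := (norm_nonneg _).trans (hCN 0 ⟨le_rfl, hT⟩)
  have hCS0 : 0 ≤ CS := (norm_nonneg _).trans (hCS 0 ⟨le_rfl, hT⟩)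
  set m₁ : ℝ := ∫ r in (0 : ℝ)..T, ‖m r‖ with hm₁
  have hm₁0 : 0 ≤ m₁ := intervalIntegral.integral_nonneg hT fun _ _ => norm_nonneg _
  set I : ℝ := ∫ q in (0 : ℝ)..R, ‖∑ i ∈ F, (f i * s i q) • b i‖ with hI
  have hI0 : 0 ≤ I := intervalIntegral.integral_nonneg hR.1 fun _ _ => norm_nonneg _
  have hl0 : 0 < l := by rw [hl]; positivity
  -- Finite sums are continuous, so the weighted norm attains its maximum `Y` on the compact
  -- triangle. At a maximum point the improved bound applies, and since the choice of `l` makes its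
  -- first coefficient at most `1/2`, that term is absorbed.
  have hcomp : IsCompact {p : ℝ × ℝ | 0 ≤ p.1 ∧ 0 ≤ p.2 ∧ p.1 + p.2 ≤ R} := by
    refine (isCompact_Icc (a := ((0 : ℝ), (0 : ℝ))) (b := (R, R))).of_isClosed_subset ?_ ?_
    · exact (isClosed_le continuous_const continuous_fst).inter
        ((isClosed_le continuous_const continuous_snd).inter
          (isClosed_le (continuous_fst.add continuous_snd) continuous_const))
    · rintro ⟨x, z⟩ ⟨h1, h2, h3⟩
      simp only at h1 h2 h3
      exact ⟨⟨h1, h2⟩, ⟨by simp only; linarith, by simp only; linarith⟩⟩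
  obtain ⟨⟨t₀, a₀⟩, ⟨h1, h2, h3⟩, hmax⟩ := hcomp.exists_isMaxOn ⟨(0, 0), by simpa using hR.1⟩
    (f := fun p : ℝ × ℝ => Real.exp (-(l * p.1)) * ‖∑ i ∈ F, y i p.1 • (s i p.2 • b i)‖)
    (Continuous.continuousOn (by fun_prop))
  simp only at h1 h2 h3
  set Y : ℝ := Real.exp (-(l * t₀)) * ‖∑ i ∈ F, y i t₀ • (s i a₀ • b i)‖ with hYdef
  have hY0 : 0 ≤ Y := by positivity
  have hY : ∀ t a, 0 ≤ t → 0 ≤ a → t + a ≤ R →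
      ‖∑ i ∈ F, y i t • (s i a • b i)‖ ≤ Y * Real.exp (l * t) := fun t a ht ha hta => by
    have : Real.exp (-(l * t)) * ‖∑ i ∈ F, y i t • (s i a • b i)‖ ≤ Y :=
      hmax (a := (t, a)) ⟨ht, ha, hta⟩
    rwa [Real.exp_neg, inv_mul_le_iff₀ (Real.exp_pos _), mul_comm] at this
  have hstep := h.norm_sum_mul_le hN hm hS hCN hCS F b hR hl0 hY0 hY h1 h2 h3
  have hratio : (CN + T * (‖κ‖ + m₁)) / l ≤ 1 / 2 := by
    rw [div_le_iff₀ hl0, hl]; linarith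
  have hYle : Y ≤ 2 * (‖σ₀‖ + T * CS) * I := by
    have e1 : ‖∑ i ∈ F, y i t₀ • (s i a₀ • b i)‖ = Y * Real.exp (l * t₀) := by
      rw [hYdef, mul_right_comm, ← Real.exp_add]; simp
    rw [e1] at hstep
    have e2 : (CN + T * (‖κ‖ + m₁)) / l * (Y * Real.exp (l * t₀)) ≤
        1 / 2 * (Y * Real.exp (l * t₀)) := by gcongr
    have e3 : Y * 1 ≤ Y * Real.exp (l * t₀) := by
      refine mul_le_mul_of_nonneg_left (Real.one_le_exp (by positivity)) hY0
    linarith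
  refine (hY t a ht ha hta).trans ?_
  clear_value Y
  rw [mul_right_comm]
  have : t ≤ T := by linarith [hR.2]
  gcongr

/-- In the last term of the reduced equation the arguments `r ≤ τ` and `t - τ` satisfy `r + (t - τ)
≤ t`. The two-parameter bound with `R = t` therefore involves the wave observation on `[0, t]` only,
which keeps the inequality of Volterra type. -/
theorem norm_sum_sub_le (h : IsReducedFamily T N m S κ σ₀ s f y)
    (hN : Continuous N) (hm : IntervalIntegrable m volume 0 T) (hS : Continuous S) {CN CS : ℝ}
    (hCN : ∀ r ∈ Icc 0 T, ‖N r‖ ≤ CN) (hCS : ∀ r ∈ Icc 0 T, ‖S r‖ ≤ CS)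
    {l : ℝ} (hl : l = 2 * (CN + T * (‖κ‖ + ∫ r in (0 : ℝ)..T, ‖m r‖)) + 1)
    (F : Finset ι) (b : ι → G) {t : ℝ} (ht : t ∈ Icc 0 T) :
    ‖∑ i ∈ F, y i t • b i - σ₀ • ∑ i ∈ F, (f i * s i t) • b i‖ ≤
      CN * (∫ q in (0 : ℝ)..t, ‖∑ i ∈ F, y i q • b i‖) +
      (CS + T * ((‖κ‖ + ∫ r in (0 : ℝ)..T, ‖m r‖) *
        (2 * (‖σ₀‖ + T * CS) * Real.exp (l * T)))) *
        ∫ q in (0 : ℝ)..t, ‖∑ i ∈ F, (f i * s i q) • b i‖ := by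
  have hT : 0 ≤ T := ht.1.trans ht.2
  have hyc : ∀ i, Continuous (y i) := fun i => (h.reduced i).continuous
  have hsc := h.continuous_mode
  have hKc := h.continuous_kernel hm hS
  have hCS0 : 0 ≤ CS := (norm_nonneg _).trans (hCS 0 ⟨le_rfl, hT⟩)
  have hY := fun (t' a : ℝ) => h.norm_sum_mul_le_integral hN hm hS hCN hCS hl F b ht (t := t')
    (a := a)
  set m₁ : ℝ := ∫ r in (0 : ℝ)..T, ‖m r‖ with hm₁
  have hm₁0 : 0 ≤ m₁ := intervalIntegral.integral_nonneg hT fun _ _ => norm_nonneg _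
  set g : ℝ → G := fun q => ∑ i ∈ F, (f i * s i q) • b i with hg
  have hgc : Continuous g := by fun_prop
  set I : ℝ := ∫ q in (0 : ℝ)..t, ‖g q‖ with hI
  have hI0 : 0 ≤ I := intervalIntegral.integral_nonneg ht.1 fun _ _ => norm_nonneg _
  set L : ℝ := 2 * (‖σ₀‖ + T * CS) * Real.exp (l * T)
  have hL0 : 0 ≤ L := by positivity
  set K : ι → ℝ → ℂ := fun i τ => f i * S τ - κ * y i τ - causalConv T m (y i) τ with hK
  have e : ∑ i ∈ F, y i t • b i - σ₀ • g t = causalConv T N (fun t => ∑ i ∈ F, y i t • b i) t +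
      ∫ τ in (0 : ℝ)..t, ∑ i ∈ F, K i τ • (s i (t - τ) • b i) := by
    rw [causalConv_sum (hN.intervalIntegrable _ _) F hyc, intervalIntegral.integral_finsetSum,
      Finset.smul_sum, ← Finset.sum_add_distrib, ← Finset.sum_sub_distrib]
    · refine Finset.sum_congr rfl fun i _ => ?_
      simp only [smul_smul, mul_comm (K i _)]
      rw [intervalIntegral.integral_smul_const]
      conv_lhs => rw [(h.reduced i).eq t ht]
      module
    · intro i _
      exact Continuous.intervalIntegrable (by fun_prop) _ _
  rw [e]
  refine (norm_add_le _ _).trans (add_le_add ?_ ?_)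
  · exact norm_causalConv_le' hT hN hCN (by fun_prop) (fun t ht => Finset.sum_eq_zero fun i _ => by
      rw [(h.reduced i).of_nonpos t ht, zero_smul]) ht
  · have := intervalIntegral.norm_integral_le_of_norm_le ht.1 (μ := volume)
      (f := fun τ => ∑ i ∈ F, K i τ • (s i (t - τ) • b i))
      (g := fun τ => CS * ‖g (t - τ)‖ + (‖κ‖ + m₁) * (L * I))
      (Filter.Eventually.of_forall fun τ hτ => h.norm_sum_kernel_le hT hm hCS F b
        ⟨hτ.1.le, hτ.2.trans ht.2⟩ fun r hr => hY r (t - τ) hr.1 (by linarith [hτ.2])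
          (by linarith [hr.2])) (Continuous.intervalIntegrable (by fun_prop) _ _)
    refine this.trans ?_
    rw [intervalIntegral.integral_add (Continuous.intervalIntegrable (by fun_prop) _ _)
      intervalIntegrable_const, intervalIntegral.integral_const_mul,
      intervalIntegral.integral_comp_sub_left (fun q => ‖g q‖),
      intervalIntegral.integral_const, sub_self, sub_zero, smul_eq_mul]
    have := mul_le_mul_of_nonneg_right ht.2
      (mul_nonneg (add_nonneg (norm_nonneg κ) hm₁0) (mul_nonneg hL0 hI0))
    linarith

end IsReducedFamily

end

/-! ### Comparison in `L²` of observed modes and observed waves. -/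

/-- A Gronwall inequality in `L²`. -/
theorem exists_integral_sq_le {T A B D : ℝ} (hT : 0 ≤ T) (hA : 0 ≤ A) (hB : 0 ≤ B) (hD : 0 ≤ D) :
    ∃ C : ℝ, 0 < C ∧ ∀ p q : ℝ → ℝ, Continuous p → Continuous q → (∀ t, 0 ≤ p t) →
      (∀ t, 0 ≤ q t) → (∀ t ∈ Icc 0 T, p t ≤ A * q t + B * (∫ s in (0 : ℝ)..t, p s) +
        D * ∫ s in (0 : ℝ)..t, q s) →
      ∫ t in (0 : ℝ)..T, p t ^ 2 ≤ C * ∫ t in (0 : ℝ)..T, q t ^ 2 := by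
  set E : ℝ := B * (Real.exp (B * T) * (A + D * T)) + D with hE
  refine ⟨2 * A ^ 2 + 2 * T ^ 2 * E ^ 2 + 1, by positivity, fun p q hp hq hp0 hq0 h => ?_⟩
  set Q : ℝ := ∫ s in (0 : ℝ)..T, q s with hQ
  have hQ0 : 0 ≤ Q := intervalIntegral.integral_nonneg hT fun t _ => hq0 t
  have hqQ : ∀ t ∈ Icc 0 T, ∫ s in (0 : ℝ)..t, q s ≤ Q := fun t ht =>
    intervalIntegral.integral_mono_interval le_rfl ht.1 ht.2
      (Filter.Eventually.of_forall hq0) (hq.intervalIntegrable _ _)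
  have hE0 : 0 ≤ E := by positivity
  have hP : ∀ t ∈ Icc 0 T, ∫ s in (0 : ℝ)..t, p s ≤ Real.exp (B * T) * ((A + D * T) * Q) := by
    intro t ht
    -- The integrating factor `exp(-B x)` for the primitive of `p`, corrected so that the hypothesis
    -- makes the whole expression nonincreasing.
    have hd : ∀ x, HasDerivAt (fun x => Real.exp (-(B * x)) * (∫ s in (0 : ℝ)..x, p s) -
        A * (∫ s in (0 : ℝ)..x, q s) - D * Q * x)
        (Real.exp (-(B * x)) * (p x - B * ∫ s in (0 : ℝ)..x, p s) - A * q x - D * Q) x := fun x => by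
      have e1 : HasDerivAt (fun x => Real.exp (-(B * x))) (Real.exp (-(B * x)) * (-B)) x := by
        simpa using (((hasDerivAt_id x).const_mul B).neg).exp
      have e2 := (hp.integral_hasStrictDerivAt 0 x).hasDerivAt
      have e3 := (hq.integral_hasStrictDerivAt 0 x).hasDerivAt
      refine (((e1.mul e2).sub (e3.const_mul A)).sub ((hasDerivAt_id x).const_mul (D * Q))).congr_deriv ?_
      ring
    have hanti := antitoneOn_of_deriv_nonpos (convex_Icc 0 T)
      (fun x _ => (hd x).continuousAt.continuousWithinAt)
      (fun x _ => (hd x).differentiableAt.differentiableWithinAt) (fun x hx => by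
        rw [(hd x).deriv]
        rw [interior_Icc] at hx
        have h1 := h x (Ioo_subset_Icc_self hx)
        have h2 := mul_le_mul_of_nonneg_left (hqQ x (Ioo_subset_Icc_self hx)) hD
        have h3 : Real.exp (-(B * x)) ≤ 1 := Real.exp_le_one_iff.2 (by nlinarith [hx.1])
        have h4 : Real.exp (-(B * x)) * (p x - B * ∫ s in (0 : ℝ)..x, p s) ≤
            Real.exp (-(B * x)) * (A * q x + D * Q) :=
          mul_le_mul_of_nonneg_left (by linarith) (Real.exp_pos _).le
        have h5 : Real.exp (-(B * x)) * (A * q x + D * Q) ≤ 1 * (A * q x + D * Q) :=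
          mul_le_mul_of_nonneg_right h3
            (add_nonneg (mul_nonneg hA (hq0 x)) (mul_nonneg hD hQ0))
        linarith)
    have := hanti ⟨le_rfl, hT⟩ ht ht.1
    simp only [intervalIntegral.integral_same, mul_zero, sub_zero] at this
    have h1 : Real.exp (-(B * t)) * ∫ s in (0 : ℝ)..t, p s ≤ (A + D * T) * Q := by
      have h2 := mul_le_mul_of_nonneg_left (hqQ t ht) hA
      have h3 := mul_le_mul_of_nonneg_left ht.2 (mul_nonneg hD hQ0)
      linarith
    rw [Real.exp_neg, inv_mul_le_iff₀ (Real.exp_pos _)] at h1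
    refine h1.trans ?_
    have := ht.2
    gcongr
  have hpt : ∀ t ∈ Icc 0 T, p t ^ 2 ≤ 2 * A ^ 2 * q t ^ 2 + 2 * (E * Q) ^ 2 := fun t ht => by
    have h1 : p t ≤ A * q t + E * Q := by
      have h2 := mul_le_mul_of_nonneg_left (hP t ht) hB
      have h3 := mul_le_mul_of_nonneg_left (hqQ t ht) hD
      have h4 := h t ht
      rw [hE]
      linarith
    have h2 : p t ^ 2 ≤ (A * q t + E * Q) ^ 2 := pow_le_pow_left₀ (hp0 t) h1 2
    nlinarith [sq_nonneg (A * q t - E * Q)]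
  have hint := intervalIntegral.integral_mono_on (μ := volume) hT
    (Continuous.intervalIntegrable (by fun_prop) _ _)
    (Continuous.intervalIntegrable (by fun_prop) _ _) hpt
  rw [intervalIntegral.integral_add (Continuous.intervalIntegrable (by fun_prop) _ _)
    intervalIntegrable_const, intervalIntegral.integral_const_mul, intervalIntegral.integral_const,
    sub_zero, smul_eq_mul] at hint
  set q2 := ∫ t in (0 : ℝ)..T, q t ^ 2 with hq2
  have hq20 : 0 ≤ q2 := intervalIntegral.integral_nonneg hT fun _ _ => sq_nonneg _
  -- Cauchy–Schwarz for `Q = ∫ q`, read off from `∫ (T q - Q)² ≥ 0`.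
  have hCS : T * Q ^ 2 ≤ T * (T * q2) := by
    have : 0 ≤ ∫ t in (0 : ℝ)..T, (T * q t - Q) ^ 2 :=
      intervalIntegral.integral_nonneg hT fun _ _ => sq_nonneg _
    have e : ∀ t, (T * q t - Q) ^ 2 = T ^ 2 * q t ^ 2 - 2 * T * Q * q t + Q ^ 2 := fun t => by ring
    simp only [e] at this
    rw [intervalIntegral.integral_add (Continuous.intervalIntegrable (by fun_prop) _ _)
      intervalIntegrable_const, intervalIntegral.integral_sub
      (Continuous.intervalIntegrable (by fun_prop) _ _)
      (Continuous.intervalIntegrable (by fun_prop) _ _), intervalIntegral.integral_const_mul,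
      intervalIntegral.integral_const_mul, intervalIntegral.integral_const, sub_zero,
      smul_eq_mul] at this
    nlinarith
  nlinarith [mul_le_mul_of_nonneg_left hCS (sq_nonneg E)]

/-- The sums of observed modes and of observed waves are comparable in `L²`. -/
theorem exists_integral_norm_sq_le {ι G : Type*} [NormedAddCommGroup G] [NormedSpace ℂ G]
    [CompleteSpace G] {T : ℝ} (hT : 0 ≤ T) {N m S : ℝ → ℂ} (α κ : ℂ) {σ₀ : ℂ} (hσ₀ : σ₀ ≠ 0)
    (hN : Continuous N) (hm : IntervalIntegrable m volume 0 T) (hS : Continuous S) :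
    ∃ C : ℝ, 0 < C ∧ ∀ (s : ι → ℝ → ℂ) (f : ι → ℂ) (y x : ι → ℝ → ℂ) (F : Finset ι) (b : ι → G),
      IsReducedFamily T N m S κ σ₀ s f y → (∀ i, Continuous (x i)) →
      (∀ i, ∀ t ∈ Icc 0 T,
        x i t = Complex.exp (-α * t) * (y i t - α * ∫ r in (0 : ℝ)..t, y i r)) →
      ∫ t in (0 : ℝ)..T, ‖∑ i ∈ F, x i t • b i‖ ^ 2 ≤
          C * (∫ t in (0 : ℝ)..T, ‖∑ i ∈ F, (f i * s i t) • b i‖ ^ 2) ∧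
        ∫ t in (0 : ℝ)..T, ‖∑ i ∈ F, (f i * s i t) • b i‖ ^ 2 ≤
          C * ∫ t in (0 : ℝ)..T, ‖∑ i ∈ F, x i t • b i‖ ^ 2 := by
  obtain ⟨CN, hCN⟩ := (isCompact_Icc (a := 0) (b := T)).exists_bound_of_continuousOn hN.continuousOn
  obtain ⟨CS, hCS⟩ := (isCompact_Icc (a := 0) (b := T)).exists_bound_of_continuousOn hS.continuousOn
  obtain ⟨E₁, hE₁⟩ := (isCompact_Icc (a := 0) (b := T)).exists_bound_of_continuousOn
    (f := fun t : ℝ => Complex.exp (α * t)) (by fun_prop)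
  obtain ⟨E₂, hE₂⟩ := (isCompact_Icc (a := 0) (b := T)).exists_bound_of_continuousOn
    (f := fun t : ℝ => Complex.exp (-α * t)) (by fun_prop)
  have h0 : (0 : ℝ) ∈ Icc 0 T := ⟨le_rfl, hT⟩
  have hCN0 : 0 ≤ CN := (norm_nonneg _).trans (hCN 0 h0)
  have hCS0 : 0 ≤ CS := (norm_nonneg _).trans (hCS 0 h0)
  have hE₁0 : 0 ≤ E₁ := (norm_nonneg _).trans (hE₁ 0 h0)
  have hE₂0 : 0 ≤ E₂ := (norm_nonneg _).trans (hE₂ 0 h0)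
  have hm₁0 : 0 ≤ ∫ r in (0 : ℝ)..T, ‖m r‖ :=
    intervalIntegral.integral_nonneg hT fun _ _ => norm_nonneg _
  set l : ℝ := 2 * (CN + T * (‖κ‖ + ∫ r in (0 : ℝ)..T, ‖m r‖)) + 1 with hl
  set D : ℝ := CS + T * ((‖κ‖ + ∫ r in (0 : ℝ)..T, ‖m r‖) *
        (2 * (‖σ₀‖ + T * CS) * Real.exp (l * T))) with hD
  have hD0 : 0 ≤ D := by positivity
  have hσpos : 0 < ‖σ₀‖ := norm_pos_iff.2 hσ₀
  obtain ⟨C₁, hC₁, H₁⟩ := exists_integral_sq_le hT (norm_nonneg σ₀) hCN0 hD0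
  -- The same inequality solved for the wave sum instead of the mode sum; it costs the factor
  -- `‖σ₀‖⁻¹`.
  obtain ⟨C₂, hC₂, H₂⟩ := exists_integral_sq_le hT (inv_nonneg.2 (norm_nonneg σ₀))
    (mul_nonneg (inv_nonneg.2 (norm_nonneg σ₀)) hD0)
    (mul_nonneg (inv_nonneg.2 (norm_nonneg σ₀)) hCN0)
  obtain ⟨C₃, hC₃, H₃⟩ := exists_integral_sq_le hT hE₂0 le_rfl (mul_nonneg hE₂0 (norm_nonneg α))
  obtain ⟨C₄, hC₄, H₄⟩ := exists_integral_sq_le hT hE₁0 (norm_nonneg α) le_rfl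
  refine ⟨C₃ * C₁ + C₂ * C₄, by positivity, fun s f y x F b h hx hxy => ?_⟩
  have hyc : ∀ i, Continuous (y i) := fun i => (h.reduced i).continuous
  have hsc := h.continuous_mode
  set g : ℝ → G := fun q => ∑ i ∈ F, (f i * s i q) • b i with hg
  set η : ℝ → G := fun t => ∑ i ∈ F, y i t • b i with hη
  set ζ : ℝ → G := fun t => ∑ i ∈ F, x i t • b i with hζ
  have hgc : Continuous g := by fun_prop
  have hηc : Continuous η := by fun_prop
  have hζc : Continuous ζ := by fun_prop
  have hsub : ∀ t ∈ Icc 0 T, ‖η t - σ₀ • g t‖ ≤ CN * (∫ q in (0 : ℝ)..t, ‖η q‖) +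
      D * ∫ q in (0 : ℝ)..t, ‖g q‖ := fun t ht => h.norm_sum_sub_le hN hm hS hCN hCS hl F b ht
  have hζη : ∀ t ∈ Icc 0 T, ζ t = Complex.exp (-α * t) • (η t - α • ∫ r in (0 : ℝ)..t, η r) :=
    fun t ht => by
      simp only [hζ, hη]
      rw [intervalIntegral.integral_finsetSum, Finset.smul_sum, ← Finset.sum_sub_distrib,
        Finset.smul_sum]
      · refine Finset.sum_congr rfl fun i _ => ?_
        rw [hxy i t ht, intervalIntegral.integral_smul_const]
        module
      · intro i _
        exact Continuous.intervalIntegrable (by fun_prop) _ _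
  have hJ : ∀ t ∈ Icc 0 T, ‖∫ r in (0 : ℝ)..t, η r‖ ≤ ∫ r in (0 : ℝ)..t, ‖η r‖ := fun t ht =>
    intervalIntegral.norm_integral_le_integral_norm ht.1
  have k₁ := H₁ (fun t => ‖η t‖) (fun t => ‖g t‖) hηc.norm hgc.norm (fun _ => norm_nonneg _)
    (fun _ => norm_nonneg _) fun t ht => by
      have h1 := norm_le_norm_add_norm_sub' (η t) (σ₀ • g t)
      have h2 := hsub t ht
      rw [norm_smul] at h1
      linarith
  have k₂ := H₂ (fun t => ‖g t‖) (fun t => ‖η t‖) hgc.norm hηc.norm (fun _ => norm_nonneg _)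
    (fun _ => norm_nonneg _) fun t ht => by
      have h1 := norm_le_norm_add_norm_sub (η t) (σ₀ • g t)
      have h2 := hsub t ht
      rw [norm_smul] at h1
      rw [mul_assoc, mul_assoc, ← mul_add, ← mul_add, ← div_eq_inv_mul, le_div_iff₀ hσpos]
      linarith
  have k₃ := H₃ (fun t => ‖ζ t‖) (fun t => ‖η t‖) hζc.norm hηc.norm (fun _ => norm_nonneg _)
    (fun _ => norm_nonneg _) fun t ht => by
      rw [hζη t ht, norm_smul, zero_mul, add_zero, mul_assoc, ← mul_add]
      refine mul_le_mul (hE₂ t ht) ((norm_sub_le _ _).trans (add_le_add le_rfl ?_))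
        (norm_nonneg _) hE₂0
      rw [norm_smul]
      exact mul_le_mul_of_nonneg_left (hJ t ht) (norm_nonneg _)
  have k₄ := H₄ (fun t => ‖η t‖) (fun t => ‖ζ t‖) hηc.norm hζc.norm (fun _ => norm_nonneg _)
    (fun _ => norm_nonneg _) fun t ht => by
      -- The passage from `η` to `ζ` is a Volterra operator of the second kind; in this form
      -- Gronwall inverts it.
      have e : η t = Complex.exp (α * t) • ζ t + α • ∫ r in (0 : ℝ)..t, η r := by
        rw [hζη t ht, smul_smul, ← Complex.exp_add]
        simp
      conv_lhs => rw [e]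
      rw [zero_mul, add_zero]
      refine (norm_add_le _ _).trans (add_le_add ?_ ?_)
      · rw [norm_smul]
        exact mul_le_mul_of_nonneg_right (hE₁ t ht) (norm_nonneg _)
      · rw [norm_smul]
        exact mul_le_mul_of_nonneg_left (hJ t ht) (norm_nonneg _)
  have n₁ : 0 ≤ ∫ t in (0 : ℝ)..T, ‖g t‖ ^ 2 :=
    intervalIntegral.integral_nonneg hT fun _ _ => sq_nonneg _
  have n₂ : 0 ≤ ∫ t in (0 : ℝ)..T, ‖ζ t‖ ^ 2 :=
    intervalIntegral.integral_nonneg hT fun _ _ => sq_nonneg _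
  constructor
  · refine k₃.trans ((mul_le_mul_of_nonneg_left k₁ hC₃.le).trans ?_)
    rw [add_mul, mul_assoc]
    exact le_add_of_nonneg_right (by positivity)
  · refine k₂.trans ((mul_le_mul_of_nonneg_left k₄ hC₂.le).trans ?_)
    rw [add_mul, mul_assoc C₂]
    exact le_add_of_nonneg_left (by positivity)

/-! ### The space `L²(0,T;G)` and primitives. -/

section L2Time

variable {G : Type*} [NormedAddCommGroup G] {T : ℝ}

theorem memLp_of_continuous {w : ℝ → G} (hw : Continuous w) :
    MemLp w 2 (volume.restrict (Icc (0 : ℝ) T)) := by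
  obtain ⟨C, hC⟩ := (isCompact_Icc (a := 0) (b := T)).exists_bound_of_continuousOn hw.continuousOn
  exact MemLp.of_bound hw.aestronglyMeasurable C
    ((ae_restrict_mem measurableSet_Icc).mono fun t ht => hC t ht)

theorem norm_toLp_sq (hT : 0 ≤ T) {w : ℝ → G} (hw : Continuous w) :
    ‖((memLp_of_continuous hw).toLp w : L2Time T G)‖ ^ 2 = ∫ t in (0 : ℝ)..T, ‖w t‖ ^ 2 := by
  have h0 : 0 ≤ ∫ t in Icc 0 T, ‖w t‖ ^ 2 := integral_nonneg fun _ => sq_nonneg _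
  rw [Lp.norm_toLp, (memLp_of_continuous hw).eLpNorm_eq_integral_rpow_norm (by norm_num)
    (by norm_num), intervalIntegral.integral_of_le hT, ← integral_Icc_eq_integral_Ioc]
  simp only [ENNReal.toReal_ofNat, Real.rpow_ofNat]
  rw [ENNReal.toReal_ofReal (by positivity), ← Real.rpow_natCast, ← Real.rpow_mul h0]
  norm_num

theorem L2Time.intervalIntegrable (hT : 0 ≤ T) (g : L2Time T G) :
    IntervalIntegrable g volume 0 T := by
  rw [intervalIntegrable_iff_integrableOn_Icc_of_le hT]
  exact (Lp.memLp g).integrable (by norm_num)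

theorem L2Time.intervalIntegrable_of_mem (hT : 0 ≤ T) (g : L2Time T G) {t : ℝ} (ht : t ∈ Icc 0 T) :
    IntervalIntegrable g volume 0 t :=
  (L2Time.intervalIntegrable hT g).mono_set (by
    rw [uIcc_of_le ht.1, uIcc_of_le hT]; exact Icc_subset_Icc_right ht.2)

theorem intervalIntegral_congr_Icc {E : Type*} [NormedAddCommGroup E] [NormedSpace ℝ E]
    {v w : ℝ → E} (h : v =ᵐ[volume.restrict (Icc (0 : ℝ) T)] w) {t : ℝ} (ht : t ∈ Icc 0 T) :
    ∫ s in (0 : ℝ)..t, v s = ∫ s in (0 : ℝ)..t, w s := by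
  refine intervalIntegral.integral_congr_ae ?_
  filter_upwards [(ae_restrict_iff' measurableSet_Icc).1 h] with s hs hst
  rw [uIoc_of_le ht.1] at hst
  exact hs ⟨hst.1.le, hst.2.trans ht.2⟩

variable [NormedSpace ℂ G]

theorem L2Time.exists_primitive [CompleteSpace G] {t : ℝ} (ht : t ∈ Icc 0 T) :
    ∃ Λ : L2Time T G →L[ℂ] G, ∀ g, Λ g = ∫ s in (0 : ℝ)..t, g s := by
  have hT : 0 ≤ T := ht.1.trans ht.2
  let L : L2Time T G →ₗ[ℂ] G :=
    { toFun := fun g => ∫ s in (0 : ℝ)..t, g s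
      map_add' := fun g g' => by
        rw [intervalIntegral_congr_Icc (Lp.coeFn_add g g') ht]
        exact intervalIntegral.integral_add (L2Time.intervalIntegrable_of_mem hT g ht)
          (L2Time.intervalIntegrable_of_mem hT g' ht)
      map_smul' := fun c g => by
        rw [intervalIntegral_congr_Icc (Lp.coeFn_smul c g) ht]
        exact intervalIntegral.integral_smul _ _ }
  refine ⟨L.mkContinuous (volume.restrict (Icc 0 T) univ ^ (1 / 2 : ℝ)).toReal fun g => ?_,
    fun g => rfl⟩
  have h1 : ‖∫ s in (0 : ℝ)..t, g s‖ ≤ ∫ s in Icc 0 T, ‖g s‖ := by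
    refine (intervalIntegral.norm_integral_le_integral_norm ht.1).trans ?_
    rw [integral_Icc_eq_integral_Ioc, ← intervalIntegral.integral_of_le hT]
    exact intervalIntegral.integral_mono_interval le_rfl ht.1 ht.2
      (Filter.Eventually.of_forall fun _ => norm_nonneg _) (L2Time.intervalIntegrable hT g).norm
  refine h1.trans ?_
  rw [integral_norm_eq_lintegral_enorm (Lp.aestronglyMeasurable g), ← eLpNorm_one_eq_lintegral_enorm,
    mul_comm, Lp.norm_def, ← ENNReal.toReal_mul]
  refine ENNReal.toReal_mono (ENNReal.mul_ne_top (Lp.eLpNorm_ne_top g) (by simp)) ?_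
  have := eLpNorm_le_eLpNorm_mul_rpow_measure_univ (p := 1) (q := 2) (by norm_num)
    (Lp.aestronglyMeasurable g)
  refine this.trans (le_of_eq ?_)
  norm_num

/-- Lebesgue differentiation recovers each function almost everywhere from its primitive. This gives
uniqueness of observations. -/
theorem L2Time.eq_of_integral_eq [CompleteSpace G] (hT : 0 ≤ T) {g g' : L2Time T G}
    (h : ∀ t ∈ Icc 0 T, ∫ s in (0 : ℝ)..t, g s = ∫ s in (0 : ℝ)..t, g' s) : g = g' := by
  refine Lp.ext ?_
  have d1 := (L2Time.intervalIntegrable hT g).ae_hasDerivAt_integral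
  have d2 := (L2Time.intervalIntegrable hT g').ae_hasDerivAt_integral
  suffices ∀ᵐ t ∂(volume.restrict (Ioo 0 T)), g t = g' t by
    rwa [restrict_Ioo_eq_restrict_Icc] at this
  rw [ae_restrict_iff' measurableSet_Ioo]
  filter_upwards [d1, d2] with t h1 h2 ht
  have htm : t ∈ uIcc 0 T := by rw [uIcc_of_le hT]; exact Ioo_subset_Icc_self ht
  have e1 := h1 htm 0 left_mem_uIcc
  have e2 := h2 htm 0 left_mem_uIcc
  refine e1.unique (e2.congr_of_eventuallyEq ?_)
  filter_upwards [Icc_mem_nhds ht.1 ht.2] with x hx using h x hx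

end L2Time

theorem sum_smul_mem_prod {E F ι : Type*} [AddCommGroup E] [Module ℂ E] [AddCommGroup F]
    [Module ℂ F] (p : Submodule ℂ (E × F)) {x : ι → E} {y : ι → F} (h : ∀ i, (x i, y i) ∈ p)
    (s : Finset ι) (a : ι → ℂ) : (∑ i ∈ s, a i • x i, ∑ i ∈ s, a i • y i) ∈ p := by
  have := Submodule.sum_mem p fun i (_ : i ∈ s) => p.smul_mem (a i) (h i)
  rwa [show ∑ i ∈ s, a i • (x i, y i) = (∑ i ∈ s, a i • x i, ∑ i ∈ s, a i • y i) from
    Prod.ext (by simp [Prod.fst_sum]) (by simp [Prod.snd_sum])] at this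

theorem integral_sum_smul {E ι : Type*} [NormedAddCommGroup E] [NormedSpace ℂ E] [CompleteSpace E]
    {x : ι → ℝ → ℂ} (hx : ∀ i, Continuous (x i)) (s : Finset ι) (v : ι → E) (t : ℝ) :
    ∫ r in (0 : ℝ)..t, ∑ i ∈ s, x i r • v i = ∑ i ∈ s, (∫ r in (0 : ℝ)..t, x i r) • v i := by
  rw [intervalIntegral.integral_finsetSum]
  · exact Finset.sum_congr rfl fun i _ => intervalIntegral.integral_smul_const _ _
  · intro i _
    have := hx i
    exact Continuous.intervalIntegrable (by fun_prop) _ _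

/-! ### Observability for finite sums of eigenmodes. -/

section Wave

variable {H G ι : Type*} [NormedAddCommGroup H] [InnerProductSpace ℂ H] [CompleteSpace H]
  [NormedAddCommGroup G] [InnerProductSpace ℂ G]
  {A : H →ₗ.[ℂ] H} {B : H →ₗ.[ℂ] G} {φ : HilbertBasis ι ℂ H} {μ : ι → ℝ} {T₀ T : ℝ}

theorem isWaveSolution_sum (hφ : IsEigenbasis A φ μ) {s c : ι → ℝ → ℂ}
    (hs : ∀ i, IsMode (μ i) (s i) (c i)) (F : Finset ι) (f : ι → ℂ) :
    IsWaveSolution A T 0 (∑ i ∈ F, f i • φ i) (fun t => ∑ i ∈ F, (f i * s i t) • φ i) := by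
  refine ⟨Finset.sum_eq_zero fun i _ => by rw [(hs i).zero, mul_zero, zero_smul],
    fun t => ∑ i ∈ F, (f i * ∫ r in (0 : ℝ)..t, s i r) • ((μ i : ℂ) • φ i), fun t _ => ⟨?_, ?_⟩⟩
  · have hfs : ∀ i, Continuous fun t => f i * s i t := fun i =>
      continuous_const.mul (hs i).continuous
    simp only [integral_sum_smul hfs, intervalIntegral.integral_const_mul]
    exact sum_smul_mem_prod _ hφ F _
  · have hd : HasDerivAt (fun t => ∑ i ∈ F, (f i * s i t) • φ i)
        (∑ i ∈ F, (f i * c i t) • φ i) t :=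
      HasDerivAt.fun_sum fun i _ => (((hs i).hasDerivAt t).const_mul (f i)).smul_const (φ i)
    refine (hd.congr_deriv ?_).hasDerivWithinAt
    rw [← Finset.sum_sub_distrib]
    refine Finset.sum_congr rfl fun i _ => ?_
    rw [← (hs i).one_sub_eq t]
    module

omit [CompleteSpace H] in
theorem energyNorm_zero (w : H) : energyNorm φ μ 0 w = ‖w‖ := by
  simp [energyNorm]

omit [CompleteSpace H] in
theorem memH1_zero : MemH1 φ μ 0 := by
  simp [MemH1, summable_zero]

/-- Under Condition (B), the eigenvectors are in the domain of `B`. -/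
theorem ConditionB.exists_mem_graph (hB : ConditionB A B φ μ T₀) (hφ : IsEigenbasis A φ μ) (i : ι) :
    ∃ b, (φ i, b) ∈ B.graph := by
  choose s c hs using fun j => exists_isMode (μ j)
  have hT : 0 < T₀ + 1 := by linarith [hB.nonneg]
  obtain ⟨C, -, hC⟩ := hB.observability (T₀ + 1) (by linarith)
  obtain ⟨g, ⟨-, hg⟩, -⟩ := hC 0 _ _ memH1_zero (isWaveSolution_sum (T := T₀ + 1) hφ
    hs {i} 1)
  simp only [Pi.one_apply, one_mul, Finset.sum_singleton,
    intervalIntegral.integral_smul_const] at hg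
  -- The observation of the wave `s i (t) φ i` puts `(∫ s i) φ i` in the domain of `B`. If `φ i` is
  -- not there, `∫ s i` vanishes identically, hence so do `s i` and its derivative `c i`, against `c
  -- i = 1 - μ i ∫ s i`.
  by_contra! hne
  have hzero : ∀ t ∈ Icc 0 (T₀ + 1), ∫ r in (0 : ℝ)..t, s i r = 0 := fun t ht => by
    by_contra h0
    have := B.graph.smul_mem (∫ r in (0 : ℝ)..t, s i r)⁻¹ (hg t ht)
    rw [Prod.smul_mk, smul_smul, inv_mul_cancel₀ h0, one_smul] at this
    exact hne _ this
  have hs0 : ∀ t ∈ Ioo 0 (T₀ + 1), s i t = 0 := fun t ht => by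
    have d := ((hs i).continuous.integral_hasStrictDerivAt 0 t).hasDerivAt
    refine d.unique ((hasDerivAt_const t (0 : ℂ)).congr_of_eventuallyEq ?_)
    filter_upwards [Icc_mem_nhds ht.1 ht.2] with x hx using hzero x hx
  have hc0 : ∀ t ∈ Ioo 0 (T₀ + 1), c i t = 0 := fun t ht => by
    refine ((hs i).hasDerivAt t).unique ((hasDerivAt_const t (0 : ℂ)).congr_of_eventuallyEq ?_)
    filter_upwards [Ioo_mem_nhds ht.1 ht.2] with x hx using hs0 x hx
  have hmem : (T₀ + 1) / 2 ∈ Ioo 0 (T₀ + 1) := ⟨by linarith, by linarith⟩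
  have := (hs i).one_sub_eq ((T₀ + 1) / 2)
  rw [hzero _ (Ioo_subset_Icc_self hmem), hc0 _ hmem] at this
  simp at this

/-- For data `(0, ∑ f i φ i)` the energy norm is the norm of the velocity. The abstract observation
must be the explicit finite sum, since both have the same primitives by single-valuedness of `B`. -/
theorem ConditionB.exists_wave_bounds [CompleteSpace G] (hB : ConditionB A B φ μ T₀)
    (hφ : IsEigenbasis A φ μ) (hT : T₀ < T) :
    ∃ C : ℝ, 0 < C ∧ ∀ (b : ι → G), (∀ i, (φ i, b i) ∈ B.graph) → ∀ (s c : ι → ℝ → ℂ),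
      (∀ i, IsMode (μ i) (s i) (c i)) → ∀ (F : Finset ι) (f : ι → ℂ),
        ∫ t in (0 : ℝ)..T, ‖∑ i ∈ F, (f i * s i t) • b i‖ ^ 2 ≤ C * ‖∑ i ∈ F, f i • φ i‖ ^ 2 ∧
        ‖∑ i ∈ F, f i • φ i‖ ^ 2 ≤ C * ∫ t in (0 : ℝ)..T, ‖∑ i ∈ F, (f i * s i t) • b i‖ ^ 2 := by
  have hT0 : 0 ≤ T := hB.nonneg.trans hT.le
  obtain ⟨C, hC, h⟩ := hB.observability T hT
  refine ⟨C ^ 2, by positivity, fun b hb s c hs F f => ?_⟩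
  obtain ⟨g, ⟨-, hg⟩, hlow, hup⟩ := h 0 _ _ memH1_zero (isWaveSolution_sum (T := T) hφ hs F f)
  have hsc := fun i => (hs i).continuous
  have hc : Continuous fun t => ∑ i ∈ F, (f i * s i t) • b i := by fun_prop
  have hgeq : g = (memLp_of_continuous hc).toLp _ := by
    refine L2Time.eq_of_integral_eq hT0 fun t ht => ?_
    rw [intervalIntegral_congr_Icc (MemLp.coeFn_toLp _) ht]
    have hgt := hg t ht
    have hfs : ∀ i, Continuous fun t => f i * s i t := fun i => continuous_const.mul (hsc i)
    simp only [integral_sum_smul hfs] at hgt ⊢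
    exact B.mem_graph_snd_inj hgt (sum_smul_mem_prod _ hb F _) rfl
  rw [energyNorm_zero] at hlow hup
  rw [← norm_toLp_sq hT0 hc, ← hgeq, ← mul_pow, ← mul_pow]
  constructor
  · exact pow_le_pow_left₀ (norm_nonneg _) hup 2
  · rw [inv_mul_le_iff₀ hC] at hlow
    exact pow_le_pow_left₀ (norm_nonneg _) hlow 2

end Wave

/-! ### Duality. -/

/-- Bounded linear functionals on a subspace of a product that is controlled by its first
component are represented by vectors of the first factor. -/
theorem exists_inner_eq_of_norm_snd_le {L H : Type*} [NormedAddCommGroup L] [InnerProductSpace ℂ L]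
    [CompleteSpace L] [NormedAddCommGroup H] [NormedSpace ℂ H] (W : Submodule ℂ (L × H)) {K : ℝ}
    (hW : ∀ p ∈ W, ‖p.2‖ ≤ K * ‖p.1‖) (ℓ : H →L[ℂ] ℂ) :
    ∃ θ : L, ∀ p ∈ W, (inner ℂ θ p.1 : ℂ) = ℓ p.2 := by
  let q : W →ₗ[ℂ] L := (LinearMap.fst ℂ L H).comp W.subtype
  have hq : Function.Injective q := by
    rw [← LinearMap.ker_eq_bot, LinearMap.ker_eq_bot']
    rintro ⟨p, hp⟩ h0
    have h1 : p.1 = 0 := h0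
    have h2 := hW p hp
    rw [h1, norm_zero, mul_zero] at h2
    exact Subtype.ext (Prod.ext h1 (norm_le_zero_iff.1 h2))
  let e := LinearEquiv.ofInjective q hq
  let ψ : LinearMap.range q →ₗ[ℂ] ℂ :=
    ℓ.toLinearMap.comp ((LinearMap.snd ℂ L H).comp (W.subtype.comp e.symm.toLinearMap))
  have hψ : ∀ p : W, ψ (e p) = ℓ p.1.2 := fun p => by simp [ψ]
  have hbound : ∀ z, ‖ψ z‖ ≤ ‖ℓ‖ * K * ‖z‖ := fun z => by
    obtain ⟨p, rfl⟩ := e.surjective z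
    rw [hψ, mul_assoc]
    exact (ℓ.le_opNorm _).trans (mul_le_mul_of_nonneg_left (hW p.1 p.2) (norm_nonneg _))
  -- The range of the first projection need not be closed, so the functional is extended by
  -- Hahn–Banach before Riesz applies.
  obtain ⟨Ψ, hΨ, -⟩ := exists_extension_norm_eq _ (ψ.mkContinuous _ hbound)
  refine ⟨(InnerProductSpace.toDual ℂ L).symm Ψ, fun p hp => ?_⟩
  rw [InnerProductSpace.toDual_symm_apply, ← hψ ⟨p, hp⟩]
  exact hΨ (e ⟨p, hp⟩)

theorem MemH2.intervalIntegrable {T : ℝ} (hT : 0 < T) {M : ℝ → ℂ} (hM : MemH2 T M) :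
    IntervalIntegrable M volume 0 T := by
  obtain ⟨M', -, -, -, -, hc, hae, -⟩ := exists_exp_memH2 hT hM
  rw [intervalIntegrable_iff_integrableOn_Icc_of_le hT.le]
  exact (hc.integrableOn_compact isCompact_Icc).congr (Filter.EventuallyEq.symm hae)

/-! ### Source solutions, existence of their observation, and recovery of the source. -/

section

variable {H G ι : Type*} [NormedAddCommGroup H] [InnerProductSpace ℂ H] [CompleteSpace H]
  [NormedAddCommGroup G] [InnerProductSpace ℂ G]
  {A : H →ₗ.[ℂ] H} {B : H →ₗ.[ℂ] G} {φ : HilbertBasis ι ℂ H} {μ : ι → ℝ} {T₀ T : ℝ}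
  {M σ : ℝ → ℂ}

theorem IsEigenbasis.inner_eq (hφ : IsEigenbasis A φ μ) (hA : IsSelfAdjoint A) (i : ι) {x y : H}
    (h : (x, y) ∈ A.graph) : (inner ℂ (φ i) y : ℂ) = μ i * inner ℂ (φ i) x := by
  have hadj : A.IsFormalAdjoint A := by
    have := A.adjoint_isFormalAdjoint hA.dense_domain
    rwa [LinearPMap.isSelfAdjoint_def.1 hA] at this
  obtain ⟨x', rfl, rfl⟩ := (A.mem_graph_iff).1 h
  obtain ⟨v, hv, hv'⟩ := (A.mem_graph_iff).1 (hφ i)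
  have := hadj v x'
  simp only at hv hv'
  rw [hv', hv, inner_smul_left] at this
  simpa using this.symm

omit [CompleteSpace H] in
theorem intervalIntegrable_conv_smul (hM : IntervalIntegrable M volume 0 T) {w : ℝ → H}
    (hw : ContinuousOn w (Icc 0 T)) {t : ℝ} (ht : t ∈ Icc 0 T) :
    IntervalIntegrable (fun s => M (t - s) • w s) volume 0 t := by
  have hsub : uIcc 0 t ⊆ uIcc 0 T := by
    rw [uIcc_of_le ht.1, uIcc_of_le (ht.1.trans ht.2)]; exact Icc_subset_Icc_right ht.2
  have h1 := ((hM.mono_set hsub).comp_sub_left t).symm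
  rw [sub_zero, sub_self] at h1
  refine h1.smul_continuousOn (hw.mono ?_)
  rw [uIcc_of_le ht.1]; exact Icc_subset_Icc_right ht.2

theorem IsSourceSolution.isScalarSourceSolution (hφ : IsEigenbasis A φ μ) (hA : IsSelfAdjoint A)
    (hM : IntervalIntegrable M volume 0 T) {f : H} {u u' : ℝ → H}
    (h : IsSourceSolution A T M σ f u u') (i : ι) :
    IsScalarSourceSolution T M σ (μ i) (inner ℂ (φ i) f) (fun t => inner ℂ (φ i) (u t))
      (fun t => inner ℂ (φ i) (u' t)) := by
  obtain ⟨hu0, hu'0, Au, hAu, hu⟩ := h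
  have hd : ∀ {v : ℝ → H} {v' : H} {t : ℝ}, HasDerivWithinAt v v' (Icc 0 T) t →
      HasDerivWithinAt (fun t => (inner ℂ (φ i) (v t) : ℂ)) (inner ℂ (φ i) v') (Icc 0 T) t :=
    fun hv => ((innerSL ℂ (φ i)).restrictScalars ℝ).hasFDerivAt.comp_hasDerivWithinAt _ hv
  refine ⟨by simp [hu0], by simp [hu'0], fun t ht => ⟨hd (hu t ht).2.1, ?_⟩⟩
  refine (hd (hu t ht).2.2).congr_deriv ?_
  have e : (inner ℂ (φ i) (∫ s in (0 : ℝ)..t, M (t - s) • Au s) : ℂ) =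
      ∫ s in (0 : ℝ)..t, M (t - s) * (μ i * inner ℂ (φ i) (u s)) := by
    have := (innerSL ℂ (φ i)).intervalIntegral_comp_comm (intervalIntegrable_conv_smul hM hAu ht)
    rw [innerSL_apply_apply] at this
    rw [← this]
    refine intervalIntegral.integral_congr fun s hs => ?_
    rw [uIcc_of_le ht.1] at hs
    rw [innerSL_apply_apply, inner_smul_right,
      hφ.inner_eq hA i (hu s ⟨hs.1, hs.2.trans ht.2⟩).1]
  rw [inner_add_right, inner_add_right, inner_neg_right, inner_smul_right, e,
    hφ.inner_eq hA i (hu t ht).1]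

theorem IsSourceSolution.integral_eq {f : H} {u u' : ℝ → H} (h : IsSourceSolution A T M σ f u u')
    {t : ℝ} (ht : t ∈ Icc 0 T) : ∫ s in (0 : ℝ)..t, u' s = u t := by
  obtain ⟨hu0, -, Au, -, hu⟩ := h
  rw [← sub_eq_integral_of_hasDerivWithinAt (fun t ht => (hu t ht).2.1)
    (fun t ht => (hu t ht).2.2.continuousWithinAt) ht, hu0, sub_zero]

omit [CompleteSpace H] in
theorem IsSourceSolution.intervalIntegrable (hT : 0 ≤ T) {f : H} {u u' : ℝ → H}
    (h : IsSourceSolution A T M σ f u u') : IntervalIntegrable u' volume 0 T := by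
  obtain ⟨-, -, Au, -, hu⟩ := h
  refine ContinuousOn.intervalIntegrable fun t ht => ?_
  rw [uIcc_of_le hT] at ht ⊢
  exact (hu t ht).2.2.continuousWithinAt

omit [CompleteSpace H] in
theorem IsObservation.unique [CompleteSpace G] (hT : 0 ≤ T) {v : ℝ → H} {g g' : L2Time T G}
    (h : IsObservation B T v g) (h' : IsObservation B T v g') : g = g' :=
  L2Time.eq_of_integral_eq hT fun t ht => B.mem_graph_snd_inj (h.2 t ht) (h'.2 t ht) rfl

/-- A source solution has an observation, and the observation controls the source. -/
theorem exists_observation [CompleteSpace G] (hA : IsSelfAdjoint A) (hφ : IsEigenbasis A φ μ)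
    (hB : ConditionB A B φ μ T₀) (hT : T₀ < T) (hM : MemH2 T M)
    (hσ : ContDiffOn ℝ 1 σ (Icc 0 T)) (hσ0 : σ 0 ≠ 0) :
    ∃ K : ℝ, 0 < K ∧ ∀ (f : H) (u u' : ℝ → H), IsSourceSolution A T M σ f u u' →
      ∃ g : L2Time T G, IsObservation B T u' g ∧ ‖f‖ ^ 2 ≤ K * ‖g‖ ^ 2 := by
  have hT0 : 0 < T := hB.nonneg.trans_lt hT
  have hMint := hM.intervalIntegrable hT0
  choose b hb using hB.exists_mem_graph hφ
  choose s c hs using fun i => exists_isMode (μ i)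
  obtain ⟨C₁, hC₁, hwave⟩ := hB.exists_wave_bounds hφ hT
  obtain ⟨α, κ, N, m, S, hS, hN, hm, hred⟩ := exists_isReducedMode hT0 hM hσ
  obtain ⟨C₂, hC₂, hcmp⟩ := exists_integral_norm_sq_le (ι := ι) (G := G) hT0.le α κ hσ0 hN hm hS
  refine ⟨C₁ * C₂, by positivity, fun f u u' hu => ?_⟩
  have hsol := hu.isScalarSourceSolution hφ hA hMint
  choose y hy hy' using fun i => hred (μ i) (s i) (c i) (hs i) _ _ _ (hsol i)
  have hext : ∀ i, ∃ x : ℝ → ℂ, Continuous x ∧ ∀ t ∈ Icc 0 T, x t = inner ℂ (φ i) (u' t) :=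
    fun i => by
      obtain ⟨x, hx, hxe, -⟩ := exists_continuous_extension hT0.le
        (w := fun t => (inner ℂ (φ i) (u' t) : ℂ))
        (fun t ht => ((hsol i).2.2 t ht).2.continuousWithinAt)
      exact ⟨x, hx, hxe⟩
  choose x hx hxe using hext
  have hfam : IsReducedFamily T N m S κ (σ 0) s (fun i => inner ℂ (φ i) f) y :=
    ⟨fun i => ⟨_, _, hs i⟩, hy⟩
  have hxc : ∀ i, Continuous fun t => x i t • b i := fun i => by
    have := hx i
    fun_prop
  set e : ι → L2Time T G := fun i => (memLp_of_continuous (hxc i)).toLp _ with he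
  have hesum : ∀ F : Finset ι, ‖∑ i ∈ F, e i‖ ^ 2 =
      ∫ t in (0 : ℝ)..T, ‖∑ i ∈ F, x i t • b i‖ ^ 2 := fun F => by
    have hc : Continuous fun t => ∑ i ∈ F, x i t • b i := by fun_prop
    rw [← norm_toLp_sq hT0.le hc]
    congr 2
    refine Lp.ext ?_
    have h1 : ∀ᵐ t ∂(volume.restrict (Icc (0 : ℝ) T)), ∀ i ∈ F, e i t = x i t • b i :=
      (ae_ball_iff F.countable_toSet).2 fun i _ => MemLp.coeFn_toLp _
    filter_upwards [MemLp.coeFn_toLp (memLp_of_continuous (T := T) hc), h1,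
      Lp.coeFn_finsetSum F e] with t h2 h3 h4
    rw [h2, h4, Finset.sum_apply]
    exact Finset.sum_congr rfl h3
  have hup : ∀ F : Finset ι, ‖∑ i ∈ F, e i‖ ^ 2 ≤
      C₁ * C₂ * ‖∑ i ∈ F, (inner ℂ (φ i) f : ℂ) • φ i‖ ^ 2 := fun F => by
    rw [hesum]
    refine (hcmp s _ y x F b hfam hx fun i t ht => (hxe i t ht).trans (hy' i t ht)).1.trans ?_
    refine (mul_le_mul_of_nonneg_left (hwave b hb s c hs F _).1 hC₂.le).trans (le_of_eq ?_)
    ring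
  have hlow : ∀ F : Finset ι, ‖∑ i ∈ F, (inner ℂ (φ i) f : ℂ) • φ i‖ ^ 2 ≤
      C₁ * C₂ * ‖∑ i ∈ F, e i‖ ^ 2 := fun F => by
    rw [hesum]
    refine (hwave b hb s c hs F _).2.trans ((mul_le_mul_of_nonneg_left (hcmp s _ y x F b hfam hx
      fun i t ht => (hxe i t ht).trans (hy' i t ht)).2 hC₁.le).trans (le_of_eq ?_))
    ring
  -- By `hup`, the Cauchy criterion for the eigenfunction expansion of `f` transfers to the family
  -- `e`, giving unconditional convergence of the candidate for `B u'`.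
  have hbasis : ∀ v : H, HasSum (fun i => (inner ℂ (φ i) v : ℂ) • φ i) v := fun v => by
    simpa only [HilbertBasis.repr_apply_apply] using φ.hasSum_repr v
  have hsummable : Summable e := by
    rw [summable_iff_vanishing_norm]
    intro ε hε
    have hK : 0 < Real.sqrt (C₁ * C₂) := Real.sqrt_pos.2 (by positivity)
    obtain ⟨F₀, hF₀⟩ := summable_iff_vanishing_norm.1 (hbasis f).summable
      (ε / Real.sqrt (C₁ * C₂)) (by positivity)
    refine ⟨F₀, fun F hF => ?_⟩
    have h1 := hF₀ F hF
    rw [lt_div_iff₀ hK] at h1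
    refine lt_of_le_of_lt (abs_le_of_sq_le_sq' ?_ (by positivity)).2 h1
    rw [mul_pow, Real.sq_sqrt (by positivity), mul_comm]
    exact hup F
  obtain ⟨g, hg⟩ := hsummable
  refine ⟨g, ⟨hu.intervalIntegrable hT0.le, fun t ht => ?_⟩, ?_⟩
  · obtain ⟨Λ, hΛ⟩ := L2Time.exists_primitive (G := G) ht
    obtain ⟨-, -, Au, -, hAu⟩ := id hu
    rw [hu.integral_eq ht, ← hΛ]
    have h1 := hbasis (u t)
    have h2 := hbasis (Au t)
    have h3 := Λ.hasSum hg
    have e3 : ∀ i, Λ (e i) = (inner ℂ (φ i) (u t) : ℂ) • b i := fun i => by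
      rw [hΛ, intervalIntegral_congr_Icc (MemLp.coeFn_toLp _) ht,
        intervalIntegral.integral_smul_const]
      have := sub_eq_integral_of_hasDerivWithinAt (w' := x i) (fun t ht => by
        rw [hxe i t ht]; exact ((hsol i).2.2 t ht).1) (hx i).continuousOn ht
      rw [← this, hu.1, inner_zero_right, sub_zero]
    simp only [e3] at h3
    simp only [hφ.inner_eq hA _ (hAu t ht).1, mul_comm (μ _ : ℂ), mul_smul] at h2
    -- Partial sums of the expansions of `u t`, of `A (u t)` and of the primitive of `g` lie in the
    -- joint graph. All three converge because `u t` is in the domain of `A`, so closedness relative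
    -- to `A` is enough.
    refine (IsClosed.mem_of_tendsto hB.closed (h1.prodMk_nhds (h2.prodMk_nhds h3))
      (Filter.Eventually.of_forall fun F => ⟨sum_smul_mem_prod _ hφ F _,
        sum_smul_mem_prod _ hb F _⟩)).2
  · have h1 := (((hbasis f).norm).pow 2)
    have h2 := ((hg.norm).pow 2).const_mul (C₁ * C₂)
    exact le_of_tendsto_of_tendsto' h1 h2 hlow

omit [CompleteSpace H] in
theorem IsSourceSolution.add (hM : IntervalIntegrable M volume 0 T) {f f' : H}
    {u u' w w' : ℝ → H} (hu : IsSourceSolution A T M σ f u u')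
    (hw : IsSourceSolution A T M σ f' w w') :
    IsSourceSolution A T M σ (f + f') (u + w) (u' + w') := by
  obtain ⟨hu0, hu'0, Au, hAu, hu⟩ := hu
  obtain ⟨hw0, hw'0, Aw, hAw, hw⟩ := hw
  refine ⟨by simp [hu0, hw0], by simp [hu'0, hw'0], Au + Aw, hAu.add hAw, fun t ht =>
    ⟨A.graph.add_mem (hu t ht).1 (hw t ht).1, (hu t ht).2.1.add (hw t ht).2.1,
    ((hu t ht).2.2.add (hw t ht).2.2).congr_deriv ?_⟩⟩
  simp only [Pi.add_apply, smul_add]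
  rw [intervalIntegral.integral_add (intervalIntegrable_conv_smul hM hAu ht)
    (intervalIntegrable_conv_smul hM hAw ht)]
  abel

omit [CompleteSpace H] in
theorem IsSourceSolution.const_smul (a : ℂ) {f : H} {u u' : ℝ → H}
    (hu : IsSourceSolution A T M σ f u u') :
    IsSourceSolution A T M σ (a • f) (a • u) (a • u') := by
  obtain ⟨hu0, hu'0, Au, hAu, hu⟩ := hu
  refine ⟨by simp [hu0], by simp [hu'0], a • Au, hAu.const_smul a, fun t ht =>
    ⟨A.graph.smul_mem a (hu t ht).1, (hu t ht).2.1.const_smul a,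
    ((hu t ht).2.2.const_smul a).congr_deriv ?_⟩⟩
  simp only [Pi.smul_apply, smul_comm _ a, smul_add, smul_neg, intervalIntegral.integral_smul]

omit [CompleteSpace H] in
theorem isSourceSolution_zero : IsSourceSolution A T M σ 0 0 0 :=
  ⟨rfl, rfl, 0, continuousOn_const, fun t _ => ⟨A.graph.zero_mem, hasDerivWithinAt_const _ _ _,
    (hasDerivWithinAt_const _ _ _).congr_deriv (by simp)⟩⟩

omit [CompleteSpace H] in
theorem IsObservation.add (hT : 0 ≤ T) {v w : ℝ → H} {g g' : L2Time T G}
    (h : IsObservation B T v g) (h' : IsObservation B T w g') :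
    IsObservation B T (v + w) (g + g') := by
  refine ⟨h.1.add h'.1, fun t ht => ?_⟩
  have hsub : uIcc 0 t ⊆ uIcc 0 T := by
    rw [uIcc_of_le ht.1, uIcc_of_le hT]; exact Icc_subset_Icc_right ht.2
  rw [intervalIntegral_congr_Icc (Lp.coeFn_add g g') ht]
  simp only [Pi.add_apply]
  rw [intervalIntegral.integral_add (h.1.mono_set hsub) (h'.1.mono_set hsub),
    intervalIntegral.integral_add (L2Time.intervalIntegrable_of_mem hT g ht)
      (L2Time.intervalIntegrable_of_mem hT g' ht)]
  exact B.graph.add_mem (h.2 t ht) (h'.2 t ht)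

omit [CompleteSpace H] in
theorem IsObservation.const_smul (a : ℂ) {v : ℝ → H} {g : L2Time T G}
    (h : IsObservation B T v g) : IsObservation B T (a • v) (a • g) := by
  refine ⟨⟨h.1.1.smul a, h.1.2.smul a⟩, fun t ht => ?_⟩
  rw [intervalIntegral_congr_Icc (Lp.coeFn_smul a g) ht]
  simp only [Pi.smul_apply, intervalIntegral.integral_smul]
  exact B.graph.smul_mem a (h.2 t ht)

omit [CompleteSpace H] in
theorem isObservation_zero : IsObservation B T 0 (0 : L2Time T G) := by
  refine ⟨intervalIntegrable_const, fun t ht => ?_⟩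
  rw [intervalIntegral_congr_Icc (Lp.coeFn_zero G 2 _) ht]
  simp

/-- The pairs formed by the observation of the velocity of a source solution and the source. -/
def observationSourcePairs (hT : 0 ≤ T) (hM : IntervalIntegrable M volume 0 T) (A : H →ₗ.[ℂ] H)
    (B : H →ₗ.[ℂ] G) (σ : ℝ → ℂ) : Submodule ℂ (L2Time T G × H) where
  carrier := {p | ∃ u u' : ℝ → H, IsSourceSolution A T M σ p.2 u u' ∧ IsObservation B T u' p.1}
  zero_mem' := ⟨0, 0, isSourceSolution_zero, isObservation_zero⟩
  add_mem' := by
    rintro _ _ ⟨u, u', h₁, h₂⟩ ⟨w, w', h₃, h₄⟩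
    exact ⟨_, _, h₁.add hM h₃, h₂.add hT h₄⟩
  smul_mem' := by
    rintro a _ ⟨u, u', h₁, h₂⟩
    exact ⟨_, _, h₁.const_smul a, h₂.const_smul a⟩

end

end

theorem theorem1p3 {H G ι : Type*}
    [NormedAddCommGroup H] [InnerProductSpace ℂ H] [CompleteSpace H]
    [NormedAddCommGroup G] [InnerProductSpace ℂ G] [CompleteSpace G]
    (A : H →ₗ.[ℂ] H) (B : H →ₗ.[ℂ] G) (φ : HilbertBasis ι ℂ H) (μ : ι → ℝ)
    (T₀ T : ℝ) (M σ : ℝ → ℂ)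
    (hA : ConditionA A) (hφ : IsEigenbasis A φ μ) (hB : ConditionB A B φ μ T₀) (hT : T₀ < T)
    (hM : MemH2 T M) (hσ : ContDiffOn ℝ 1 σ (Set.Icc 0 T)) (hσ0 : σ 0 ≠ 0) :
    ∃ θ : ι → L2Time T G, ∀ (f : H) (u u' : ℝ → H), IsSourceSolution A T M σ f u u' →
      ∃ Bu' : L2Time T G, IsObservation B T u' Bu' ∧
        HasSum (fun n => (inner ℂ (θ n) Bu' : ℂ) • φ n) f := by
  have hT0 : 0 < T := hB.nonneg.trans_lt hT
  have hMint := hM.intervalIntegrable hT0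
  obtain ⟨K, hK, hobs⟩ := exists_observation hA.selfAdjoint hφ hB hT hM hσ hσ0
  -- Uniqueness of observations turns the estimate for one observation into an estimate on every
  -- pair, so the source is a bounded linear function of the observation.
  have hW : ∀ p ∈ observationSourcePairs hT0.le hMint A B σ,
      ‖p.2‖ ≤ Real.sqrt K * ‖p.1‖ := by
    rintro ⟨g, f⟩ ⟨u, u', hu, hg⟩
    obtain ⟨g', hg', hle⟩ := hobs f u u' hu
    obtain rfl := hg.unique hT0.le hg'
    refine (abs_le_of_sq_le_sq' ?_ (by positivity)).2
    rw [mul_pow, Real.sq_sqrt hK.le]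
    exact hle
  choose θ hθ using fun n => exists_inner_eq_of_norm_snd_le _ hW (innerSL ℂ (φ n))
  refine ⟨θ, fun f u u' hu => ?_⟩
  obtain ⟨g, hg, -⟩ := hobs f u u' hu
  refine ⟨g, hg, ?_⟩
  have := φ.hasSum_repr f
  simpa only [HilbertBasis.repr_apply_apply, hθ _ (g, f) ⟨u, u', hu, hg⟩, innerSL_apply_apply]
    using this
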